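/- Let $\mathcal X,\mathcal X_r,\mathcal S,\mathcal Y,\mathcal Z$ be finite alphabets. A memoryless state-dependent semideterministic relay channel is given by a pmf $p(s)$ on $\mathcal S$, a channel $p(y|x,x_r,s)$ and a function $z:\mathcal X\times\mathcal X_r\times\mathcal S\to\mathcal Z$; the state $S_i$ is i.i.d. with pmf $p(s)$, the destination receives $Y_i$ and the relay receives $Z_i=z(X_i,X_{r,i},S_i)$. The state is known causally to the source, and to the destination, but not to the relay: an $(n,2^{nR},\epsilon)$ code consists of source encoding functions $x_i:[1:2^{nR}]\times\mathcal S^i\to\mathcal X$, relay encoding functions $x_{r,i}:\mathcal Z^{i-1}\to\mathcal X_r$ ($1\le i\le n$) and a decoding function $\hat m:\mathcal Y^n\times\mathcal S^n\to[1:2^{nR}]$ such that $\Pr\{\hat m(Y^n,S^n)\ne M\}\le\epsilon$, where the message $M$ is uniform on $[1:2^{nR}]$ and independent of the states ($2^{nR}$ is rounded up to an integer). A rate $R\ge 0$ is achievable if for every $\epsilon>0$ there is an $(n,2^{nR},\epsilon)$ code for all sufficiently large $n$, and the capacity $C$ is the supremum of the achievable rates. Then $$C=\max_{p(x_r)\,p(x|x_r,s)}\min\bigl\{I(X,X_r;Y|S),\;H(Z|S,X_r)+I(X;Y|S,X_r,Z)\bigr\},$$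 where the maximum (which is attained) is over all pmfs $p(x_r)$ on $\mathcal X_r$ and all conditional pmfs $p(x|x_r,s)$ on $\mathcal X$, the information quantities are in bits, and they are evaluated for $(S,X_r,X,Y)$ with joint pmf $p(s)p(x_r)p(x|x_r,s)p(y|x,x_r,s)$ and $Z=z(X,X_r,S)$. -/

import Mathlib

noncomputable section

namespace FiniteInfo

/-- The probability `P(A = a)` when the mass function on the finite sample space is `p`. -/
def law {Ω α : Type*} [Fintype Ω] (p : Ω → ℝ) (A : Ω → α) (a : α) : ℝ :=
  open Classical in ∑ ω, if A ω = a then p ω else 0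

/-- The conditional entropy `H(A | B) = - ∑ p(a, b) log₂ p(a | b)` in bits
(terms with `p(a, b) = 0` vanish). -/
def condEntropy {Ω α β : Type*} [Fintype Ω] [Fintype α] [Fintype β]
    (p : Ω → ℝ) (A : Ω → α) (B : Ω → β) : ℝ :=
  -∑ a, ∑ b, law p (fun ω => (A ω, B ω)) (a, b) *
    Real.logb 2 (law p (fun ω => (A ω, B ω)) (a, b) / law p B b)

/-- The conditional mutual information `I(A ; B | C) = H(A | C) - H(A | B, C)` in bits. -/
def condMutualInfo {Ω α β γ : Type*} [Fintype Ω] [Fintype α] [Fintype β] [Fintype γ]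
    (p : Ω → ℝ) (A : Ω → α) (B : Ω → β) (C : Ω → γ) : ℝ :=
  condEntropy p A C - condEntropy p A (fun ω => (B ω, C ω))

end FiniteInfo

/-- A memoryless state-dependent semideterministic relay channel with finite alphabets: input `𝒳`,
relay input `𝒳r`, state `𝒮`, output `𝒴`, and signal `𝒵` received at the relay. -/
structure RelayChannel (𝒳 𝒳r 𝒮 𝒴 𝒵 : Type*) [Fintype 𝒮] [Fintype 𝒴] where
  /-- the state pmf `p(s)` -/
  pS : 𝒮 → ℝ
  pS_mem : pS ∈ stdSimplex ℝ 𝒮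
  /-- the channel `p(y | x, x_r, s)` -/
  W : 𝒳 → 𝒳r → 𝒮 → 𝒴 → ℝ
  W_mem : ∀ x xr s, W x xr s ∈ stdSimplex ℝ 𝒴
  /-- the deterministic link `Z = z(X, X_r, S)` to the relay -/
  z : 𝒳 → 𝒳r → 𝒮 → 𝒵

/-- The encoding and decoding functions of a code with blocklength `n` and `k` messages; the times
`1, …, n` are indexed by `0, …, n - 1`. At time `i` the source uses the message and the states up
to and including the current one, and the relay uses only the signals that it received before. -/
structure RelayCode (𝒳 𝒳r 𝒮 𝒴 𝒵 : Type*) (n k : ℕ) where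
  enc : (i : Fin n) → Fin k → (Fin (i.val + 1) → 𝒮) → 𝒳
  relay : (i : Fin n) → (Fin i.val → 𝒵) → 𝒳r
  dec : (Fin n → 𝒴) → (Fin n → 𝒮) → Fin k

namespace RelayCode

variable {𝒳 𝒳r 𝒮 𝒴 𝒵 : Type*} [Fintype 𝒮] [Fintype 𝒴] {n k : ℕ}

/-- The symbol `x_i(m, s^i)` that the source sends at time `i`. -/
def srcSymbol (c : RelayCode 𝒳 𝒳r 𝒮 𝒴 𝒵 n k) (m : Fin k) (s : Fin n → 𝒮) (i : Fin n) : 𝒳 :=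
  c.enc i m (fun j => s ⟨j.val, lt_of_lt_of_le j.isLt i.isLt⟩)

/-- The signal `z_i = z(x_i, x_{r,i}, s_i)` received by the relay at time `i`, where
`x_{r,i} = x_{r,i}(z^{i-1})`, if the message is `m` and the state sequence is `s`. -/
def relaySignal (ch : RelayChannel 𝒳 𝒳r 𝒮 𝒴 𝒵) (c : RelayCode 𝒳 𝒳r 𝒮 𝒴 𝒵 n k)
    (m : Fin k) (s : Fin n → 𝒮) (i : Fin n) : 𝒵 :=
  ch.z (c.srcSymbol m s i)
    (c.relay i (fun j => relaySignal ch c m s ⟨j.val, j.isLt.trans i.isLt⟩)) (s i)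
termination_by i.val
decreasing_by exact j.isLt

/-- The symbol `x_{r,i}(z^{i-1})` that the relay sends at time `i`. -/
def relaySymbol (ch : RelayChannel 𝒳 𝒳r 𝒮 𝒴 𝒵) (c : RelayCode 𝒳 𝒳r 𝒮 𝒴 𝒵 n k)
    (m : Fin k) (s : Fin n → 𝒮) (i : Fin n) : 𝒳r :=
  c.relay i (fun j => c.relaySignal ch m s ⟨j.val, j.isLt.trans i.isLt⟩)

/-- The error probability `Pr{m̂(Y^n, S^n) ≠ M}`, where `M` is uniform on the `k` messages, the
states are i.i.d. with pmf `p(s)` and independent of `M`, and the channel is memoryless. -/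
def errorProb (ch : RelayChannel 𝒳 𝒳r 𝒮 𝒴 𝒵) (c : RelayCode 𝒳 𝒳r 𝒮 𝒴 𝒵 n k) : ℝ :=
  ∑ m : Fin k, ∑ s : Fin n → 𝒮, ∑ y : Fin n → 𝒴,
    if c.dec y s ≠ m then
      (1 / (k : ℝ)) * (∏ i, ch.pS (s i)) *
        ∏ i, ch.W (c.srcSymbol m s i) (c.relaySymbol ch m s i) (s i) (y i)
    else 0

end RelayCode

namespace RelayChannel

variable {𝒳 𝒳r 𝒮 𝒴 𝒵 : Type*} [Fintype 𝒮] [Fintype 𝒴]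

/-- The rate `R ≥ 0` is achievable: for every `ε > 0` and all sufficiently large `n` there is an
`(n, 2^{nR}, ε)` code (the number of messages is rounded up to an integer). -/
def Achievable (ch : RelayChannel 𝒳 𝒳r 𝒮 𝒴 𝒵) (R : ℝ) : Prop :=
  0 ≤ R ∧ ∀ ε : ℝ, 0 < ε → ∃ n₀ : ℕ, ∀ n : ℕ, n₀ ≤ n →
    ∃ c : RelayCode 𝒳 𝒳r 𝒮 𝒴 𝒵 n ⌈(2 : ℝ) ^ ((n : ℝ) * R)⌉₊, c.errorProb ch ≤ ε

/-- `C` is the capacity: the supremum of the achievable rates. -/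
def IsCapacity (ch : RelayChannel 𝒳 𝒳r 𝒮 𝒴 𝒵) (C : ℝ) : Prop :=
  IsLUB {R : ℝ | ch.Achievable R} C

/-- The joint pmf `p(s) p(x_r) p(x | x_r, s) p(y | x, x_r, s)` of `(S, X_r, X, Y)`, where `q` is
`p(x_r)` and `r x_r s` is `p(· | x_r, s)`. -/
def jointPMF (ch : RelayChannel 𝒳 𝒳r 𝒮 𝒴 𝒵) (q : 𝒳r → ℝ) (r : 𝒳r → 𝒮 → 𝒳 → ℝ) :
    𝒮 × 𝒳r × 𝒳 × 𝒴 → ℝ :=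
  fun (s, xr, x, y) => ch.pS s * q xr * r xr s x * ch.W x xr s y

/-- `min {I(X, X_r ; Y | S), H(Z | S, X_r) + I(X ; Y | S, X_r, Z)}` for this joint pmf, with
`Z = z(X, X_r, S)`. -/
def objective [Fintype 𝒳] [Fintype 𝒳r] [Fintype 𝒵]
    (ch : RelayChannel 𝒳 𝒳r 𝒮 𝒴 𝒵) (q : 𝒳r → ℝ) (r : 𝒳r → 𝒮 → 𝒳 → ℝ) : ℝ :=
  let p := ch.jointPMF q r
  let S : 𝒮 × 𝒳r × 𝒳 × 𝒴 → 𝒮 := fun (s, _, _, _) => s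
  let Xr : 𝒮 × 𝒳r × 𝒳 × 𝒴 → 𝒳r := fun (_, xr, _, _) => xr
  let X : 𝒮 × 𝒳r × 𝒳 × 𝒴 → 𝒳 := fun (_, _, x, _) => x
  let Y : 𝒮 × 𝒳r × 𝒳 × 𝒴 → 𝒴 := fun (_, _, _, y) => y
  let Z : 𝒮 × 𝒳r × 𝒳 × 𝒴 → 𝒵 := fun ω => ch.z (X ω) (Xr ω) (S ω)
  min (FiniteInfo.condMutualInfo p (fun ω => (X ω, Xr ω)) Y S)
    (FiniteInfo.condEntropy p Z (fun ω => (S ω, Xr ω)) +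
      FiniteInfo.condMutualInfo p X Y (fun ω => (S ω, Xr ω, Z ω)))

end RelayChannel

end

/-! ### Sums against product laws and causal kernels; entropies as expectations. -/

namespace FiniteInfo

/-! Since `Z` is a function of `(X, X_r, S)`, the second term of the minimum is `I(X; Y, Z | S,
X_r)`. Both terms are thus expectations of log-likelihood ratios, of `W` against `outLaw = p(y|s)`
and against `linkLaw = p(y,z|x_r,s)` (`objective_eq`). Converse and achievability work with these
ratios directly; neither typical sequences nor block Markov coding is used.

Converse. The relay symbol at time `i` does not depend on `S_i`, so the time-averaged law of `(S,
X_r, X)` is `p(s) p(x_r) p(x|x_r,s)` (`exists_timeAverage_eq`). A form of Fano's inequality (`fano`)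
compares the true output law with any weights `b m s y` that are bounded by a subnormalized `B s y`
free of the message. Products of `outLaw` give the first bound. Products of `linkLaw` along the
trajectory of `m` give the second: they are bounded by the sum over all relay sequences, which has
mass one by causality. As the comparison laws come from the averaged law itself, the bounds
single-letterize exactly, without a concavity argument.

Achievability. At each time the random codebook has an independent relay symbol for every full past
of the relay, and a source symbol for every message, relay symbol and state. The source knows the
states, hence can simulate the relay. Compare the true message with a wrong one whose relay signals
first differ at time `τ`. Up to `τ` the two share the relay inputs and only the source symbols are
independent given them; after `τ` the relay pasts differ forever, so the relay symbols are
independent too. The matching test statistic adds `linkDensity` before `τ` and `outDensity` after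
it. The decoder asks for a message that passes these tests for all `τ`. The true message passes by a
Chernoff bound, because both densities have mean above the rate; a wrong one passes with small
probability because likelihood ratios have mean at most one (`sum_book_pair_le_one`). The union over
the `n + 1` values of `τ` costs only a polynomial factor. -/

theorem sum_pi_snoc {n : ℕ} {α : Fin (n + 1) → Type*} [∀ i, Fintype (α i)]
    (F : (∀ i, α i) → ℝ) :
    ∑ f, F f = ∑ f : (∀ i : Fin n, α i.castSucc), ∑ a : α (Fin.last n), F (Fin.snoc f a) := by
  rw [← (Fin.snocEquiv α).sum_comp, Fintype.sum_prod_type_right]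
  rfl

theorem sum_pi_prod {ι α : Type*} [Fintype ι] [DecidableEq ι] [Fintype α] (w : ι → α → ℝ) :
    ∑ f : ι → α, ∏ l, w l (f l) = ∏ l, ∑ a, w l a := by
  rw [Finset.prod_univ_sum, Fintype.piFinset_univ]

theorem sum_pi_prod_eq_one {ι α : Type*} [Fintype ι] [DecidableEq ι] [Fintype α] {w : ι → α → ℝ}
    (hw : ∀ i, ∑ a, w i a = 1) : ∑ f : ι → α, ∏ l, w l (f l) = 1 := by
  simp [sum_pi_prod, hw]

theorem sum_pi_prod_mul_mul {ι α : Type*} [Fintype ι] [DecidableEq ι] [Fintype α] (w : ι → α → ℝ)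
    (hw : ∀ i, ∑ a, w i a = 1) {i j : ι} (hij : i ≠ j) (u v : α → ℝ) :
    ∑ f : ι → α, (∏ l, w l (f l)) * (u (f i) * v (f j)) =
      (∑ a, w i a * u a) * ∑ b, w j b * v b := by
  have h1 : ∀ f : ι → α, (∏ l, w l (f l)) * (u (f i) * v (f j)) =
      ∏ l, w l (f l) * ((if l = i then u (f l) else 1) * (if l = j then v (f l) else 1)) := by
    intro f
    simp only [Finset.prod_mul_distrib, Finset.prod_ite_eq', Finset.mem_univ, if_true]
  simp only [h1]
  rw [sum_pi_prod (fun l a => w l a * ((if l = i then u a else 1) * (if l = j then v a else 1)))]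
  have h2 : ∀ l, (∑ a, w l a * ((if l = i then u a else 1) * (if l = j then v a else 1))) =
      (if l = i then ∑ a, w i a * u a else 1) * (if l = j then ∑ b, w j b * v b else 1) := by
    intro l
    by_cases hi : l = i
    · subst hi; simp [hij]
    · by_cases hj : l = j
      · subst hj; simp [hi]
      · simp [hi, hj, hw]
  simp only [h2, Finset.prod_mul_distrib, Finset.prod_ite_eq', Finset.mem_univ, if_true]

/-- Distinct coordinates of a product law are independent: expand `φ` in indicators of pairs and
apply the factorized case. -/
theorem sum_pi_two {ι α : Type*} [Fintype ι] [DecidableEq ι] [Fintype α] (w : ι → α → ℝ)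
    (hw : ∀ i, ∑ a, w i a = 1) {i j : ι} (hij : i ≠ j) (φ : α → α → ℝ) :
    ∑ f : ι → α, (∏ l, w l (f l)) * φ (f i) (f j) =
      ∑ a, w i a * ∑ b, w j b * φ a b := by
  classical
  have h1 : ∀ f : ι → α, (∏ l, w l (f l)) * φ (f i) (f j) =
      ∑ a, ∑ b, (∏ l, w l (f l)) *
        ((if f i = a then 1 else 0) * (if f j = b then φ a b else 0)) := by
    intro f
    simp
  simp only [h1]
  rw [Finset.sum_comm]
  refine Finset.sum_congr rfl fun a _ => ?_
  rw [Finset.sum_comm, Finset.mul_sum]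
  refine Finset.sum_congr rfl fun b _ => ?_
  rw [sum_pi_prod_mul_mul w hw hij (fun x => if x = a then 1 else 0)
    (fun x => if x = b then φ a b else 0)]
  simp

theorem sum_pi_one {ι α : Type*} [Fintype ι] [DecidableEq ι] [Fintype α] (w : ι → α → ℝ)
    (hw : ∀ i, ∑ a, w i a = 1) (i : ι) (u : α → ℝ) :
    ∑ f : ι → α, (∏ l, w l (f l)) * u (f i) = ∑ a, w i a * u a := by
  have h1 : ∀ f : ι → α, (∏ l, w l (f l)) * u (f i) =
      ∏ l, w l (f l) * (if l = i then u (f l) else 1) := by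
    intro f
    simp only [Finset.prod_mul_distrib, Finset.prod_ite_eq', Finset.mem_univ, if_true]
  simp only [h1]
  rw [sum_pi_prod (fun l a => w l a * (if l = i then u a else 1))]
  have h2 : ∀ l, (∑ a, w l a * (if l = i then u a else 1)) =
      (if l = i then ∑ a, w i a * u a else 1) := by
    intro l
    by_cases hi : l = i
    · subst hi; simp
    · simp [hi, hw]
  simp only [h2]
  simp

/-- A coordinate of an i.i.d. sequence is independent of the other coordinates. -/
theorem sum_pi_mul_of_update {n : ℕ} {α : Type*} [Fintype α] {p : α → ℝ} (hp : ∑ a, p a = 1)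
    (i : Fin n) (u : α → ℝ) (f : (Fin n → α) → ℝ)
    (hf : ∀ s a, f (Function.update s i a) = f s) :
    ∑ s : Fin n → α, (∏ j, p (s j)) * (u (s i) * f s) =
      (∑ a, p a * u a) * ∑ s : Fin n → α, (∏ j, p (s j)) * f s := by
  classical
  cases n with
  | zero => exact i.elim0
  | succ n =>
    obtain ⟨a₀, _⟩ : (Finset.univ : Finset α).Nonempty := by
      by_contra h
      rw [Finset.not_nonempty_iff_eq_empty] at h
      simp [h] at hp
    have hins : ∀ (a : α) (t : Fin n → α),
        f (Fin.insertNth i a t) = f (Fin.insertNth i a₀ t) := by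
      intro a t
      rw [← hf (Fin.insertNth i a t) a₀]
      simp
    have key : ∀ v : α → ℝ, ∑ s : Fin (n + 1) → α, (∏ j, p (s j)) * (v (s i) * f s) =
        (∑ a, p a * v a) * ∑ t : Fin n → α, (∏ j, p (t j)) * f (Fin.insertNth i a₀ t) := by
      intro v
      rw [← (Fin.insertNthEquiv (fun _ => α) i).sum_comp, Fintype.sum_prod_type,
        Finset.sum_mul_sum]
      refine Finset.sum_congr rfl fun a _ => Finset.sum_congr rfl fun t _ => ?_
      simp only [Fin.insertNthEquiv, Equiv.coe_fn_mk, Fin.prod_univ_succAbove _ i,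
        Fin.insertNth_apply_same, Fin.insertNth_apply_succAbove]
      rw [hins]
      ring
    rw [key u]
    have h1 := key (fun _ => 1)
    simp only [one_mul, mul_one, hp] at h1
    rw [h1]

/-- The chain rule for the total mass of sequentially specified kernels. -/
theorem sum_pi_causal_le_one {α : Type*} [Fintype α] :
    ∀ {n : ℕ} (K : (i : Fin n) → (Fin i.val → α) → α → ℝ), (∀ i h a, 0 ≤ K i h a) →
      (∀ i h, ∑ a, K i h a ≤ 1) →
      ∑ z : Fin n → α, ∏ i, K i (fun j => z ⟨j.val, j.isLt.trans i.isLt⟩) (z i) ≤ 1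
  | 0, _, _, _ => by simp
  | n + 1, K, h0, h1 => by
    rw [sum_pi_snoc]
    refine le_trans ?_ (sum_pi_causal_le_one (fun i => K i.castSucc) (fun i => h0 i.castSucc)
      (fun i => h1 i.castSucc))
    refine Finset.sum_le_sum fun z _ => ?_
    have h2 : ∀ a : α, ∏ i, K i (fun j => (Fin.snoc z a : Fin (n + 1) → α)
          ⟨j.val, j.isLt.trans i.isLt⟩) ((Fin.snoc z a : Fin (n + 1) → α) i) =
        (∏ i : Fin n, K i.castSucc (fun j => z ⟨j.val, j.isLt.trans i.isLt⟩) (z i)) *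
          K (Fin.last n) z a := by
      intro a
      rw [Fin.prod_univ_castSucc]
      congr 1
      · refine Finset.prod_congr rfl fun i _ => ?_
        rw [Fin.snoc_castSucc (α := fun _ => α)]
        congr 1
        funext j
        exact Fin.snoc_castSucc (α := fun _ => α) a z ⟨j.val, j.isLt.trans i.isLt⟩
      · rw [Fin.snoc_last]
        congr 1
        funext j
        exact Fin.snoc_castSucc (α := fun _ => α) a z ⟨j.val, j.isLt⟩
    rw [Finset.sum_congr rfl fun a _ => h2 a, ← Finset.mul_sum]
    exact mul_le_of_le_one_right (Finset.prod_nonneg fun i _ => h0 _ _ _) (h1 _ _)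

theorem sum_law_mul {Ω α : Type*} [Fintype Ω] [Fintype α] (p : Ω → ℝ) (A : Ω → α) (g : α → ℝ) :
    ∑ a, law p A a * g a = ∑ ω, p ω * g (A ω) := by
  classical
  simp only [law, Finset.sum_mul]
  rw [Finset.sum_comm]
  refine Finset.sum_congr rfl fun ω _ => ?_
  simp [ite_mul]

/-- As expectations over one sample space, several conditional entropies can be combined pointwise
inside a single sum. -/
theorem condEntropy_eq_sum {Ω α β : Type*} [Fintype Ω] [Fintype α] [Fintype β]
    (p : Ω → ℝ) (A : Ω → α) (B : Ω → β) :
    condEntropy p A B = -∑ ω, p ω *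
      Real.logb 2 (law p (fun ω => (A ω, B ω)) (A ω, B ω) / law p B (B ω)) := by
  rw [condEntropy, ← sum_law_mul p (fun ω => (A ω, B ω))
    (fun ab => Real.logb 2 (law p (fun ω => (A ω, B ω)) ab / law p B ab.2)),
    Fintype.sum_prod_type]

end FiniteInfo

/-! ### Information densities and the existence of the maximum. -/

noncomputable section

namespace RelayChannel

open FiniteInfo

section

variable {𝒳 𝒳r 𝒮 𝒴 𝒵 : Type*} [Fintype 𝒮] [Fintype 𝒴] (ch : RelayChannel 𝒳 𝒳r 𝒮 𝒴 𝒵)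

theorem pS_nonneg (s : 𝒮) : 0 ≤ ch.pS s := ch.pS_mem.1 s

theorem sum_pS : ∑ s, ch.pS s = 1 := ch.pS_mem.2

theorem W_nonneg (x : 𝒳) (xr : 𝒳r) (s : 𝒮) (y : 𝒴) : 0 ≤ ch.W x xr s y := (ch.W_mem x xr s).1 y

theorem sum_W (x : 𝒳) (xr : 𝒳r) (s : 𝒮) : ∑ y, ch.W x xr s y = 1 := (ch.W_mem x xr s).2

end

variable {𝒳 𝒳r 𝒮 𝒴 𝒵 : Type*} [Fintype 𝒳] [Fintype 𝒮] [Fintype 𝒴]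

open Classical in
/-- The conditional law `p(y, z | x_r, s)` of the output and the relay signal. -/
def linkLaw (ch : RelayChannel 𝒳 𝒳r 𝒮 𝒴 𝒵) (r : 𝒳r → 𝒮 → 𝒳 → ℝ)
    (xr : 𝒳r) (s : 𝒮) (y : 𝒴) (z : 𝒵) : ℝ :=
  ∑ x, if ch.z x xr s = z then r xr s x * ch.W x xr s y else 0

/-- The information density of `H(Z | S, X_r) + I(X ; Y | S, X_r, Z) = I(X ; Y, Z | S, X_r)`,
in nats. -/
def linkDensity (ch : RelayChannel 𝒳 𝒳r 𝒮 𝒴 𝒵) (r : 𝒳r → 𝒮 → 𝒳 → ℝ)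
    (s : 𝒮) (xr : 𝒳r) (x : 𝒳) (y : 𝒴) : ℝ :=
  Real.log (ch.W x xr s y / ch.linkLaw r xr s y (ch.z x xr s))

section

variable (ch : RelayChannel 𝒳 𝒳r 𝒮 𝒴 𝒵) {r : 𝒳r → 𝒮 → 𝒳 → ℝ}

theorem linkLaw_nonneg (hr : ∀ xr s, r xr s ∈ stdSimplex ℝ 𝒳)
    (xr : 𝒳r) (s : 𝒮) (y : 𝒴) (z : 𝒵) : 0 ≤ ch.linkLaw r xr s y z := by
  refine Finset.sum_nonneg fun x _ => ?_
  split_ifs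
  · exact mul_nonneg ((hr xr s).1 x) (ch.W_nonneg _ _ _ _)
  · rfl

theorem le_linkLaw (hr : ∀ xr s, r xr s ∈ stdSimplex ℝ 𝒳)
    (x : 𝒳) (xr : 𝒳r) (s : 𝒮) (y : 𝒴) :
    r xr s x * ch.W x xr s y ≤ ch.linkLaw r xr s y (ch.z x xr s) := by
  classical
  refine le_trans (le_of_eq (if_pos rfl).symm) (Finset.single_le_sum
    (f := fun x' => if ch.z x' xr s = ch.z x xr s then r xr s x' * ch.W x' xr s y else 0)
    (fun x' _ => ?_) (Finset.mem_univ x)) |>.trans (le_of_eq ?_)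
  · split_ifs
    · exact mul_nonneg ((hr xr s).1 x') (ch.W_nonneg _ _ _ _)
    · rfl
  · unfold linkLaw
    exact Finset.sum_congr rfl fun _ _ => by congr

theorem sum_linkLaw [Fintype 𝒵] (hr : ∀ xr s, r xr s ∈ stdSimplex ℝ 𝒳) (xr : 𝒳r) (s : 𝒮) :
    ∑ z, ∑ y, ch.linkLaw r xr s y z = 1 := by
  classical
  unfold linkLaw
  rw [Finset.sum_comm]
  calc ∑ y, ∑ z, ∑ x, (if ch.z x xr s = z then r xr s x * ch.W x xr s y else 0)
      = ∑ y, ∑ x, r xr s x * ch.W x xr s y := by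
        refine Finset.sum_congr rfl fun y _ => ?_
        rw [Finset.sum_comm]
        simp
    _ = ∑ x, r xr s x * ∑ y, ch.W x xr s y := by
        rw [Finset.sum_comm]
        simp only [Finset.mul_sum]
    _ = 1 := by simp [sum_W, (hr _ _).2]

end

variable [Fintype 𝒳r]

/-- The conditional law `p(y | s)` of the output induced by `p(x_r)` and `p(x | x_r, s)`. -/
def outLaw (ch : RelayChannel 𝒳 𝒳r 𝒮 𝒴 𝒵) (q : 𝒳r → ℝ) (r : 𝒳r → 𝒮 → 𝒳 → ℝ)
    (s : 𝒮) (y : 𝒴) : ℝ :=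
  ∑ xr, ∑ x, q xr * r xr s x * ch.W x xr s y

/-- The information density of `I(X, X_r ; Y | S)`, in nats. -/
def outDensity (ch : RelayChannel 𝒳 𝒳r 𝒮 𝒴 𝒵) (q : 𝒳r → ℝ) (r : 𝒳r → 𝒮 → 𝒳 → ℝ)
    (s : 𝒮) (xr : 𝒳r) (x : 𝒳) (y : 𝒴) : ℝ :=
  Real.log (ch.W x xr s y / ch.outLaw q r s y)

/-- The expectation of `f (S, X_r, X, Y)` under `jointPMF`. -/
def expect (ch : RelayChannel 𝒳 𝒳r 𝒮 𝒴 𝒵) (q : 𝒳r → ℝ) (r : 𝒳r → 𝒮 → 𝒳 → ℝ)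
    (f : 𝒮 → 𝒳r → 𝒳 → 𝒴 → ℝ) : ℝ :=
  ∑ s, ∑ xr, ∑ x, ∑ y, ch.pS s * q xr * r xr s x * ch.W x xr s y * f s xr x y

section

variable (ch : RelayChannel 𝒳 𝒳r 𝒮 𝒴 𝒵) {q : 𝒳r → ℝ} {r : 𝒳r → 𝒮 → 𝒳 → ℝ}

theorem outLaw_nonneg (hq : q ∈ stdSimplex ℝ 𝒳r) (hr : ∀ xr s, r xr s ∈ stdSimplex ℝ 𝒳)
    (s : 𝒮) (y : 𝒴) : 0 ≤ ch.outLaw q r s y :=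
  Finset.sum_nonneg fun xr _ => Finset.sum_nonneg fun x _ =>
    mul_nonneg (mul_nonneg (hq.1 xr) ((hr xr s).1 x)) (ch.W_nonneg _ _ _ _)

theorem le_outLaw (hq : q ∈ stdSimplex ℝ 𝒳r) (hr : ∀ xr s, r xr s ∈ stdSimplex ℝ 𝒳)
    (x : 𝒳) (xr : 𝒳r) (s : 𝒮) (y : 𝒴) :
    q xr * r xr s x * ch.W x xr s y ≤ ch.outLaw q r s y := by
  have h0 : ∀ xr x, 0 ≤ q xr * r xr s x * ch.W x xr s y := fun xr x =>
    mul_nonneg (mul_nonneg (hq.1 xr) ((hr xr s).1 x)) (ch.W_nonneg _ _ _ _)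
  refine (Finset.single_le_sum (f := fun x => q xr * r xr s x * ch.W x xr s y)
    (fun x _ => h0 xr x) (Finset.mem_univ x)).trans ?_
  exact Finset.single_le_sum (f := fun xr => ∑ x, q xr * r xr s x * ch.W x xr s y)
    (fun xr _ => Finset.sum_nonneg fun x _ => h0 xr x) (Finset.mem_univ xr)

theorem sum_outLaw (hq : q ∈ stdSimplex ℝ 𝒳r) (hr : ∀ xr s, r xr s ∈ stdSimplex ℝ 𝒳) (s : 𝒮) :
    ∑ y, ch.outLaw q r s y = 1 := by
  unfold outLaw
  rw [Finset.sum_comm]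
  calc ∑ xr, ∑ y, ∑ x, q xr * r xr s x * ch.W x xr s y
      = ∑ xr, q xr * ∑ x, r xr s x * ∑ y, ch.W x xr s y := by
        refine Finset.sum_congr rfl fun xr _ => ?_
        rw [Finset.sum_comm, Finset.mul_sum]
        refine Finset.sum_congr rfl fun x _ => ?_
        rw [Finset.mul_sum, Finset.mul_sum]
        exact Finset.sum_congr rfl fun y _ => by ring
    _ = 1 := by simp [sum_W, (hr _ _).2, hq.2]

theorem sum_jointPMF_mul (f : 𝒮 × 𝒳r × 𝒳 × 𝒴 → ℝ) :
    ∑ ω, ch.jointPMF q r ω * f ω = ch.expect q r fun s xr x y => f (s, xr, x, y) := by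
  simp only [Fintype.sum_prod_type, expect, jointPMF]

theorem law_jointPMF {α : Type*} [DecidableEq α] (A : 𝒮 × 𝒳r × 𝒳 × 𝒴 → α) (a : α) :
    law (ch.jointPMF q r) A a = ∑ s, ∑ xr, ∑ x, ∑ y, if A (s, xr, x, y) = a then
      ch.pS s * (q xr * (r xr s x * ch.W x xr s y)) else 0 := by
  simp only [law, Fintype.sum_prod_type, jointPMF, mul_assoc]

/-- Bayes' rule: wherever the joint mass is positive, `p(x,x_r|y,s) / p(x,x_r|s)` equals `W /
outLaw`. Where the mass vanishes both sides contribute zero. -/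
theorem condMutualInfo_out (hq : q ∈ stdSimplex ℝ 𝒳r) (hr : ∀ xr s, r xr s ∈ stdSimplex ℝ 𝒳) :
    condMutualInfo (ch.jointPMF q r) (fun ω => (ω.2.2.1, ω.2.1)) (fun ω => ω.2.2.2)
      (fun ω => ω.1) = ch.expect q r (ch.outDensity q r) / Real.log 2 := by
  classical
  have l1 : ∀ s xr x, law (ch.jointPMF q r) (fun ω => ((ω.2.2.1, ω.2.1), ω.1)) ((x, xr), s) =
      ch.pS s * (q xr * r xr s x) := by
    intro s xr x
    simp [law_jointPMF, ite_and, Finset.sum_ite_irrel, ← Finset.mul_sum, sum_W]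
  have l2 : ∀ s, law (ch.jointPMF q r) (fun ω => ω.1) s = ch.pS s := by
    intro s
    rw [law_jointPMF, Fintype.sum_eq_single s]
    · simp [← Finset.mul_sum, sum_W, (hr _ _).2, hq.2]
    · intro s' h; simp [h]
  have l3 : ∀ s xr x y, law (ch.jointPMF q r)
      (fun ω => ((ω.2.2.1, ω.2.1), (ω.2.2.2, ω.1))) ((x, xr), (y, s)) =
      ch.pS s * (q xr * (r xr s x * ch.W x xr s y)) := by
    intro s xr x y
    simp [law_jointPMF, ite_and, Finset.sum_ite_irrel]
  have l4 : ∀ s y, law (ch.jointPMF q r) (fun ω => (ω.2.2.2, ω.1)) (y, s) =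
      ch.pS s * ch.outLaw q r s y := by
    intro s y
    simp [law_jointPMF, ite_and, Finset.sum_ite_irrel, ← Finset.mul_sum, outLaw, mul_assoc]
  rw [condMutualInfo, condEntropy_eq_sum, condEntropy_eq_sum, sum_jointPMF_mul, sum_jointPMF_mul]
  simp only [l1, l2, l3, l4]
  rw [neg_sub_neg, expect, expect, expect, Finset.sum_div]
  simp only [← Finset.sum_sub_distrib, Finset.sum_div]
  refine Finset.sum_congr rfl fun s _ => Finset.sum_congr rfl fun xr _ => Finset.sum_congr rfl
    fun x _ => Finset.sum_congr rfl fun y _ => ?_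
  by_cases hp : ch.pS s * q xr * r xr s x * ch.W x xr s y = 0
  · simp [hp]
  rw [outDensity, ← mul_sub, mul_div_assoc (ch.pS s * q xr * r xr s x * ch.W x xr s y)]
  congr 1
  have hP : ch.outLaw q r s y ≠ 0 := by
    intro h
    have h1 := ch.le_outLaw hq hr x xr s y
    have h2 : 0 ≤ q xr * r xr s x * ch.W x xr s y :=
      mul_nonneg (mul_nonneg (hq.1 xr) ((hr xr s).1 x)) (ch.W_nonneg _ _ _ _)
    exact hp (by rw [mul_assoc, mul_assoc, ← mul_assoc (q xr), le_antisymm (h ▸ h1) h2, mul_zero])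
  simp only [mul_eq_zero, not_or] at hp
  obtain ⟨⟨⟨h1, h2⟩, h3⟩, h4⟩ := hp
  rw [← Real.log_div_log, ← Real.log_div_log, ← sub_div, ← Real.log_div (by positivity)
    (by positivity)]
  congr 2
  field_simp

/-- Pointwise, `1/p(z|x_r,s)` from the entropy times `p(x|y,s,x_r,z) / p(x|s,x_r,z)` from the mutual
information telescopes to `W / linkLaw`, because `z` is determined by `(x, x_r, s)`. -/
theorem condEntropy_add_condMutualInfo_link [Fintype 𝒵]
    (hr : ∀ xr s, r xr s ∈ stdSimplex ℝ 𝒳) :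
    condEntropy (ch.jointPMF q r) (fun ω => ch.z ω.2.2.1 ω.2.1 ω.1) (fun ω => (ω.1, ω.2.1)) +
      condMutualInfo (ch.jointPMF q r) (fun ω => ω.2.2.1) (fun ω => ω.2.2.2)
        (fun ω => (ω.1, ω.2.1, ch.z ω.2.2.1 ω.2.1 ω.1)) =
      ch.expect q r (ch.linkDensity r) / Real.log 2 := by
  classical
  -- The conditional law `p(z|x_r,s)`; it cancels in the end.
  let pz : 𝒳r → 𝒮 → 𝒵 → ℝ := fun xr s z => ∑ x, if ch.z x xr s = z then r xr s x else 0
  have l1 : ∀ s xr z, law (ch.jointPMF q r)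
      (fun ω => (ch.z ω.2.2.1 ω.2.1 ω.1, (ω.1, ω.2.1))) (z, (s, xr)) =
      ch.pS s * (q xr * pz xr s z) := by
    intro s xr z
    rw [law_jointPMF, Fintype.sum_eq_single s, Fintype.sum_eq_single xr]
    · simp [Finset.sum_ite_irrel, ← Finset.mul_sum, sum_W]
      simp only [pz, Finset.mul_sum]
      refine Finset.sum_congr rfl fun x _ => ?_
      split_ifs <;> simp
    · intro xr' h; simp [h]
    · intro s' h; simp [h]
  have l2 : ∀ s xr, law (ch.jointPMF q r) (fun ω => (ω.1, ω.2.1)) (s, xr) =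
      ch.pS s * q xr := by
    intro s xr
    simp [law_jointPMF, ite_and, Finset.sum_ite_irrel, ← Finset.mul_sum, sum_W, (hr _ _).2]
  have l3 : ∀ s xr x, law (ch.jointPMF q r)
      (fun ω => (ω.2.2.1, (ω.1, ω.2.1, ch.z ω.2.2.1 ω.2.1 ω.1))) (x, (s, xr, ch.z x xr s)) =
      ch.pS s * (q xr * r xr s x) := by
    intro s xr x
    rw [law_jointPMF, Fintype.sum_eq_single s, Fintype.sum_eq_single xr, Fintype.sum_eq_single x]
    · simp [← Finset.mul_sum, sum_W]
    · intro x' h; simp [h]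
    · intro xr' h; simp [h]
    · intro s' h; simp [h]
  have l4 : ∀ s xr z, law (ch.jointPMF q r)
      (fun ω => (ω.1, ω.2.1, ch.z ω.2.2.1 ω.2.1 ω.1)) (s, xr, z) =
      ch.pS s * (q xr * pz xr s z) := by
    intro s xr z
    rw [law_jointPMF, Fintype.sum_eq_single s, Fintype.sum_eq_single xr]
    · simp [Finset.sum_ite_irrel, ← Finset.mul_sum, sum_W]
      simp only [pz, Finset.mul_sum]
      refine Finset.sum_congr rfl fun x _ => ?_
      split_ifs <;> simp
    · intro xr' h; simp [h]
    · intro s' h; simp [h]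
  have l5 : ∀ s xr x y, law (ch.jointPMF q r)
      (fun ω => (ω.2.2.1, (ω.2.2.2, (ω.1, ω.2.1, ch.z ω.2.2.1 ω.2.1 ω.1))))
        (x, (y, (s, xr, ch.z x xr s))) =
      ch.pS s * (q xr * (r xr s x * ch.W x xr s y)) := by
    intro s xr x y
    rw [law_jointPMF, Fintype.sum_eq_single s, Fintype.sum_eq_single xr, Fintype.sum_eq_single x,
      Fintype.sum_eq_single y]
    · simp
    · intro x' h; simp [h]
    · intro x' h; simp [h]
    · intro xr' h; simp [h]
    · intro s' h; simp [h]
  have l6 : ∀ s xr y z, law (ch.jointPMF q r)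
      (fun ω => (ω.2.2.2, (ω.1, ω.2.1, ch.z ω.2.2.1 ω.2.1 ω.1))) (y, (s, xr, z)) =
      ch.pS s * (q xr * ch.linkLaw r xr s y z) := by
    intro s xr y z
    rw [law_jointPMF, Fintype.sum_eq_single s, Fintype.sum_eq_single xr]
    · simp [ite_and, linkLaw, Finset.mul_sum]
    · intro xr' h; simp [h]
    · intro s' h; simp [h]
  rw [condMutualInfo, condEntropy_eq_sum, condEntropy_eq_sum, condEntropy_eq_sum,
    sum_jointPMF_mul, sum_jointPMF_mul, sum_jointPMF_mul]
  simp only [l1, l2, l3, l4, l5, l6]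
  rw [neg_sub_neg, neg_add_eq_sub, expect, expect, expect, expect]
  simp only [← Finset.sum_sub_distrib, Finset.sum_div]
  refine Finset.sum_congr rfl fun s _ => Finset.sum_congr rfl fun xr _ => Finset.sum_congr rfl
    fun x _ => Finset.sum_congr rfl fun y _ => ?_
  by_cases hp : ch.pS s * q xr * r xr s x * ch.W x xr s y = 0
  · simp [hp]
  rw [linkDensity, ← mul_sub, ← mul_sub, mul_div_assoc (ch.pS s * q xr * r xr s x * ch.W x xr s y)]
  congr 1
  simp only [mul_eq_zero, not_or] at hp
  obtain ⟨⟨⟨h1, h2⟩, h3⟩, h4⟩ := hp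
  have h3' : 0 < r xr s x := lt_of_le_of_ne ((hr xr s).1 x) (Ne.symm h3)
  have hP : ch.linkLaw r xr s y (ch.z x xr s) ≠ 0 :=
    ((mul_pos h3' (lt_of_le_of_ne (ch.W_nonneg _ _ _ _) (Ne.symm h4))).trans_le
      (ch.le_linkLaw hr x xr s y)).ne'
  have hz : pz xr s (ch.z x xr s) ≠ 0 := by
    refine (h3'.trans_le ?_).ne'
    refine le_trans (le_of_eq (if_pos rfl).symm) (Finset.single_le_sum
      (f := fun x' => if ch.z x' xr s = ch.z x xr s then r xr s x' else 0)
      (fun x' _ => ?_) (Finset.mem_univ x))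
    split_ifs
    · exact (hr xr s).1 x'
    · rfl
  rw [← Real.log_div_log, ← Real.log_div_log, ← Real.log_div_log, ← sub_div, ← sub_div,
    ← Real.log_div (by positivity) (by positivity), ← Real.log_div (by positivity) (by positivity)]
  congr 2
  field_simp

theorem objective_eq [Fintype 𝒵] (hq : q ∈ stdSimplex ℝ 𝒳r)
    (hr : ∀ xr s, r xr s ∈ stdSimplex ℝ 𝒳) :
    ch.objective q r = min (ch.expect q r (ch.outDensity q r) / Real.log 2)
      (ch.expect q r (ch.linkDensity r) / Real.log 2) := by
  rw [← ch.condMutualInfo_out hq hr, ← ch.condEntropy_add_condMutualInfo_link hr]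
  rfl

/-- Splitting the logarithm isolates a polynomial in `(q, r)` and terms `t log t`, which stay
continuous where a probability tends to zero, unlike the density itself. -/
theorem expect_outDensity (hq : q ∈ stdSimplex ℝ 𝒳r) (hr : ∀ xr s, r xr s ∈ stdSimplex ℝ 𝒳) :
    ch.expect q r (ch.outDensity q r) = ch.expect q r (fun s xr x y => Real.log (ch.W x xr s y)) -
      ∑ s, ∑ y, ch.pS s * (ch.outLaw q r s y * Real.log (ch.outLaw q r s y)) := by
  have h1 : ∑ s, ∑ y, ch.pS s * (ch.outLaw q r s y * Real.log (ch.outLaw q r s y)) =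
      ch.expect q r fun s _ _ y => Real.log (ch.outLaw q r s y) := by
    refine Finset.sum_congr rfl fun s _ => ?_
    have h2 : ∀ y L, ch.outLaw q r s y * L =
        ∑ xr, ∑ x, q xr * r xr s x * ch.W x xr s y * L := fun y L => by
      simp only [outLaw, Finset.sum_mul]
    simp only [h2, Finset.mul_sum]
    rw [Finset.sum_comm]
    refine Finset.sum_congr rfl fun xr _ => ?_
    rw [Finset.sum_comm]
    exact Finset.sum_congr rfl fun x _ => Finset.sum_congr rfl fun y _ => by ring
  rw [h1, expect, expect, expect]
  simp only [← Finset.sum_sub_distrib]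
  refine Finset.sum_congr rfl fun s _ => Finset.sum_congr rfl fun xr _ => Finset.sum_congr rfl
    fun x _ => Finset.sum_congr rfl fun y _ => ?_
  by_cases hp : q xr * r xr s x * ch.W x xr s y = 0
  · have : ch.pS s * q xr * r xr s x * ch.W x xr s y = 0 := by
      linear_combination ch.pS s * hp
    simp [this]
  have h2 : 0 ≤ q xr * r xr s x * ch.W x xr s y :=
    mul_nonneg (mul_nonneg (hq.1 xr) ((hr xr s).1 x)) (ch.W_nonneg _ _ _ _)
  have hP := ((lt_of_le_of_ne h2 (Ne.symm hp)).trans_le (ch.le_outLaw hq hr x xr s y)).ne'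
  rw [outDensity, Real.log_div (right_ne_zero_of_mul hp) hP]
  ring

theorem expect_linkDensity [Fintype 𝒵] (hr : ∀ xr s, r xr s ∈ stdSimplex ℝ 𝒳) :
    ch.expect q r (ch.linkDensity r) = ch.expect q r (fun s xr x y => Real.log (ch.W x xr s y)) -
      ∑ s, ∑ xr, ∑ y, ∑ z, ch.pS s * q xr *
        (ch.linkLaw r xr s y z * Real.log (ch.linkLaw r xr s y z)) := by
  classical
  have h1 : ∑ s, ∑ xr, ∑ y, ∑ z, ch.pS s * q xr *
        (ch.linkLaw r xr s y z * Real.log (ch.linkLaw r xr s y z)) =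
      ch.expect q r fun s xr x y => Real.log (ch.linkLaw r xr s y (ch.z x xr s)) := by
    refine Finset.sum_congr rfl fun s _ => Finset.sum_congr rfl fun xr _ => ?_
    rw [Finset.sum_comm (f := fun x y => ch.pS s * q xr * r xr s x * ch.W x xr s y *
      Real.log (ch.linkLaw r xr s y (ch.z x xr s)))]
    refine Finset.sum_congr rfl fun y _ => ?_
    have h2 : ∀ z L, ch.linkLaw r xr s y z * L =
        ∑ x, if ch.z x xr s = z then r xr s x * ch.W x xr s y * L else 0 := by
      intro z L
      rw [linkLaw, Finset.sum_mul]
      refine Finset.sum_congr rfl fun x _ => ?_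
      split_ifs <;> simp
    simp only [h2, ← Finset.mul_sum]
    rw [Finset.sum_comm]
    simp only [Finset.sum_ite_eq, Finset.mem_univ, if_true, Finset.mul_sum]
    exact Finset.sum_congr rfl fun x _ => by ring
  rw [h1, expect, expect, expect]
  simp only [← Finset.sum_sub_distrib]
  refine Finset.sum_congr rfl fun s _ => Finset.sum_congr rfl fun xr _ => Finset.sum_congr rfl
    fun x _ => Finset.sum_congr rfl fun y _ => ?_
  by_cases hp : r xr s x * ch.W x xr s y = 0
  · have : ch.pS s * q xr * r xr s x * ch.W x xr s y = 0 := by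
      linear_combination ch.pS s * q xr * hp
    simp [this]
  have h2 : 0 ≤ r xr s x * ch.W x xr s y := mul_nonneg ((hr xr s).1 x) (ch.W_nonneg _ _ _ _)
  have hP := ((lt_of_le_of_ne h2 (Ne.symm hp)).trans_le (ch.le_linkLaw hr x xr s y)).ne'
  rw [linkDensity, Real.log_div (right_ne_zero_of_mul hp) hP]
  ring

/-- On the product of simplices the objective agrees with the split form, which is continuous
everywhere. -/
theorem continuousOn_objective [Fintype 𝒵] :
    ContinuousOn (fun qr : (𝒳r → ℝ) × (𝒳r → 𝒮 → 𝒳 → ℝ) => ch.objective qr.1 qr.2)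
      (stdSimplex ℝ 𝒳r ×ˢ Set.univ.pi fun _ => Set.univ.pi fun _ => stdSimplex ℝ 𝒳) := by
  classical
  have h : ∀ qr ∈ stdSimplex ℝ 𝒳r ×ˢ Set.univ.pi fun _ : 𝒳r => Set.univ.pi fun _ : 𝒮 =>
      stdSimplex ℝ 𝒳, ch.objective qr.1 qr.2 = min
        ((ch.expect qr.1 qr.2 (fun s xr x y => Real.log (ch.W x xr s y)) -
          ∑ s, ∑ y, ch.pS s * (ch.outLaw qr.1 qr.2 s y * Real.log (ch.outLaw qr.1 qr.2 s y))) /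
            Real.log 2)
        ((ch.expect qr.1 qr.2 (fun s xr x y => Real.log (ch.W x xr s y)) -
          ∑ s, ∑ xr, ∑ y, ∑ z, ch.pS s * qr.1 xr *
            (ch.linkLaw qr.2 xr s y z * Real.log (ch.linkLaw qr.2 xr s y z))) /
            Real.log 2) := by
    rintro ⟨q, r⟩ ⟨hq, hr⟩
    simp only [Set.mem_pi, Set.mem_univ, true_implies] at hr
    rw [ch.objective_eq hq hr, ch.expect_outDensity hq hr, ch.expect_linkDensity hr]
  refine ContinuousOn.congr (Continuous.continuousOn ?_) h
  have c1 : ∀ s y, Continuous fun qr : (𝒳r → ℝ) × (𝒳r → 𝒮 → 𝒳 → ℝ) =>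
      ch.outLaw qr.1 qr.2 s y := by
    intro s y
    unfold outLaw
    fun_prop
  have c2 : ∀ xr s y z, Continuous fun qr : (𝒳r → ℝ) × (𝒳r → 𝒮 → 𝒳 → ℝ) =>
      ch.linkLaw qr.2 xr s y z := by
    intro xr s y z
    unfold linkLaw
    refine continuous_finsetSum _ fun x _ => ?_
    split_ifs <;> fun_prop
  have c3 : Continuous fun qr : (𝒳r → ℝ) × (𝒳r → 𝒮 → 𝒳 → ℝ) =>
      ch.expect qr.1 qr.2 (fun s xr x y => Real.log (ch.W x xr s y)) := by
    unfold expect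
    fun_prop
  have c4 := fun s y => Real.continuous_mul_log.comp (c1 s y)
  have c5 := fun xr s y z => Real.continuous_mul_log.comp (c2 xr s y z)
  simp only [Function.comp_def] at c4 c5
  fun_prop

theorem exists_isGreatest_objective [Nonempty 𝒳] [Nonempty 𝒳r] [Fintype 𝒵] :
    ∃ C : ℝ, IsGreatest {v : ℝ | ∃ q ∈ stdSimplex ℝ 𝒳r, ∃ r : 𝒳r → 𝒮 → 𝒳 → ℝ,
        (∀ xr s, r xr s ∈ stdSimplex ℝ 𝒳) ∧ v = ch.objective q r} C := by
  classical
  obtain ⟨qr, hqr, hmax⟩ := IsCompact.exists_isMaxOn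
    ((isCompact_stdSimplex ℝ 𝒳r).prod (isCompact_univ_pi fun _ : 𝒳r =>
      isCompact_univ_pi fun _ : 𝒮 => isCompact_stdSimplex ℝ 𝒳))
    ⟨(Pi.single (Classical.arbitrary 𝒳r) 1, fun _ _ => Pi.single (Classical.arbitrary 𝒳) 1),
      single_mem_stdSimplex _ _, fun _ _ _ _ => single_mem_stdSimplex _ _⟩
    ch.continuousOn_objective
  refine ⟨ch.objective qr.1 qr.2, ⟨qr.1, hqr.1, qr.2, fun xr s => hqr.2 xr trivial s trivial, rfl⟩,
    ?_⟩
  rintro v ⟨q, hq, r, hr, rfl⟩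
  exact hmax (a := (q, r)) ⟨hq, fun xr _ s _ => hr xr s⟩

end

end RelayChannel

end

/-! ### Converse: Fano's inequality and single-letterization. -/

noncomputable section

namespace RelayCode

open FiniteInfo

section

variable {𝒳 𝒳r 𝒮 𝒴 𝒵 : Type*} [Fintype 𝒮] [Fintype 𝒴] {n k : ℕ}
  (ch : RelayChannel 𝒳 𝒳r 𝒮 𝒴 𝒵) (c : RelayCode 𝒳 𝒳r 𝒮 𝒴 𝒵 n k)

theorem relaySignal_congr (m : Fin k) {s s' : Fin n → 𝒮} (i : Fin n)
    (h : ∀ j ≤ i, s j = s' j) : c.relaySignal ch m s i = c.relaySignal ch m s' i := by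
  obtain ⟨i, hi⟩ := i
  induction i using Nat.strong_induction_on with
  | _ i ih =>
    rw [relaySignal, relaySignal, h ⟨i, hi⟩ le_rfl]
    congr 1
    · unfold srcSymbol
      congr 1
      funext j
      exact h _ (Fin.mk_le_mk.2 (Nat.lt_succ_iff.1 j.isLt))
    · congr 1
      funext j
      exact ih j.val j.isLt _ fun l hl => h l (hl.trans (Fin.mk_le_mk.2 j.isLt.le))

/-- The relay's past signals involve only earlier states. This makes the relay symbol independent of
the current state, and so gives a law `p(x_r)` rather than `p(x_r|s)`. -/
theorem relaySymbol_update (m : Fin k) (s : Fin n → 𝒮) (i : Fin n) (a : 𝒮) :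
    c.relaySymbol ch m (Function.update s i a) i = c.relaySymbol ch m s i := by
  unfold relaySymbol
  congr 1
  funext j
  refine relaySignal_congr ch c m _ fun l hl => Function.update_of_ne ?_ _ _
  rintro rfl
  exact absurd (Fin.mk_le_mk.1 hl) (not_le.2 j.isLt)

theorem relaySignal_eq (m : Fin k) (s : Fin n → 𝒮) (i : Fin n) :
    c.relaySignal ch m s i = ch.z (c.srcSymbol m s i) (c.relaySymbol ch m s i) (s i) := by
  rw [relaySignal, relaySymbol]

/-- The probability of the output sequence `y` given the message and the states. -/
def outProb (m : Fin k) (s : Fin n → 𝒮) (y : Fin n → 𝒴) : ℝ :=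
  ∏ i, ch.W (c.srcSymbol m s i) (c.relaySymbol ch m s i) (s i) (y i)

theorem outProb_nonneg (m : Fin k) (s : Fin n → 𝒮) (y : Fin n → 𝒴) : 0 ≤ c.outProb ch m s y :=
  Finset.prod_nonneg fun _ _ => ch.W_nonneg _ _ _ _

theorem sum_outProb (m : Fin k) (s : Fin n → 𝒮) : ∑ y, c.outProb ch m s y = 1 :=
  sum_pi_prod_eq_one (w := fun i => ch.W (c.srcSymbol m s i) (c.relaySymbol ch m s i) (s i))
    fun _ => ch.sum_W _ _ _

theorem prod_pS_nonneg (s : Fin n → 𝒮) : 0 ≤ ∏ i, ch.pS (s i) :=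
  Finset.prod_nonneg fun _ _ => ch.pS_nonneg _

theorem sum_prod_pS : ∑ s : Fin n → 𝒮, ∏ i, ch.pS (s i) = 1 :=
  sum_pi_prod_eq_one (w := fun _ => ch.pS) fun _ => ch.sum_pS

theorem sum_joint (hk : 0 < k) :
    ∑ m : Fin k, ∑ s, ∑ y, (1 / (k : ℝ)) * (∏ i, ch.pS (s i)) * c.outProb ch m s y = 1 := by
  simp only [← Finset.mul_sum, sum_outProb, mul_one, sum_prod_pS]
  simp [hk.ne']

/-- Fano's inequality by comparison with a family `b` of subnormalized output laws. -/
theorem fano (hk : 0 < k) (b : Fin k → (Fin n → 𝒮) → (Fin n → 𝒴) → ℝ)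
    (B : (Fin n → 𝒮) → (Fin n → 𝒴) → ℝ) (hb : ∀ m s y, 0 ≤ b m s y)
    (hbB : ∀ m s y, b m s y ≤ B s y) (hB : ∀ s, ∑ y, B s y ≤ 1)
    (hpos : ∀ m s y, 0 < ∏ i, ch.pS (s i) → 0 < c.outProb ch m s y → 0 < b m s y) :
    (1 - c.errorProb ch) * Real.log k - 1 ≤
      ∑ m : Fin k, ∑ s, ∑ y, (1 / (k : ℝ)) * (∏ i, ch.pS (s i)) * c.outProb ch m s y *
        Real.log (c.outProb ch m s y / b m s y) := by
  have hk' : (0 : ℝ) < k := Nat.cast_pos.2 hk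
  have hpt : ∀ m s y, (1 / (k : ℝ)) * (∏ i, ch.pS (s i)) * c.outProb ch m s y * Real.log k -
      (if c.dec y s ≠ m then (1 / (k : ℝ)) * (∏ i, ch.pS (s i)) * c.outProb ch m s y else 0) *
        Real.log k + (1 / (k : ℝ)) * (∏ i, ch.pS (s i)) * c.outProb ch m s y -
      ((1 / (k : ℝ)) * (∏ i, ch.pS (s i)) * b m s y +
        if c.dec y s = m then (∏ i, ch.pS (s i)) * b m s y else 0) ≤
      (1 / (k : ℝ)) * (∏ i, ch.pS (s i)) * c.outProb ch m s y *
        Real.log (c.outProb ch m s y / b m s y) := by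
    intro m s y
    have h0 := prod_pS_nonneg ch s
    have ha := c.outProb_nonneg ch m s y
    have hp := hpos m s y
    have hb0 := hb m s y
    generalize (∏ i, ch.pS (s i)) = v at *
    generalize c.outProb ch m s y = a at *
    generalize b m s y = b at *
    rcases h0.eq_or_lt with rfl | h0
    · simp
    rcases ha.eq_or_lt with rfl | ha
    · simp only [mul_zero, zero_mul, ite_self, sub_zero, add_zero, zero_sub]
      have : 0 ≤ if c.dec y s = m then v * b else 0 := by split_ifs <;> positivity
      have h2 : 0 ≤ 1 / (k : ℝ) * v * b := by positivity
      linarith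
    have hbp := hp h0 ha
    -- This is `log t ≥ 1 - 1/t` at `t = a / (C b)`. It is used with `C = k` on correct decoding and
    -- `C = 1` on errors. The total mass of `a` contributes `+1`, and the two correction terms in
    -- `b` cost at most `1` each, whence the `- 1` in the statement.
    have key : ∀ C : ℝ, 0 < C → a * Real.log C + a - C * b ≤ a * Real.log (a / b) := by
      intro C hC
      have h1 := Real.one_sub_inv_le_log_of_pos (x := a / (C * b)) (by positivity)
      have h2 : Real.log (a / (C * b)) = Real.log (a / b) - Real.log C := by
        rw [← Real.log_div (by positivity) (by positivity)]
        congr 1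
        field_simp
      rw [h2, inv_div] at h1
      have h3 := mul_le_mul_of_nonneg_left h1 ha.le
      have h4 : a * (1 - C * b / a) = a - C * b := by field_simp
      rw [h4] at h3
      linarith
    by_cases hd : c.dec y s = m
    · simp only [hd, ne_eq, not_true_eq_false, if_false, if_true]
      have h1 := mul_le_mul_of_nonneg_left (key k hk') (by positivity : 0 ≤ 1 / (k : ℝ) * v)
      have h2 : 1 / (k : ℝ) * v * (k * b) = v * b := by field_simp
      have h3 : 0 ≤ 1 / (k : ℝ) * v * b := by positivity
      linarith
    · simp only [hd, ne_eq, not_false_eq_true, if_true, if_false]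
      have h1 := mul_le_mul_of_nonneg_left (key 1 one_pos) (by positivity : 0 ≤ 1 / (k : ℝ) * v)
      rw [Real.log_one] at h1
      linarith
  have hsum := Finset.sum_le_sum fun m (_ : m ∈ Finset.univ) => Finset.sum_le_sum
    fun s (_ : s ∈ Finset.univ) => Finset.sum_le_sum fun y (_ : y ∈ Finset.univ) => hpt m s y
  refine le_trans ?_ hsum
  simp only [Finset.sum_sub_distrib, Finset.sum_add_distrib, ← Finset.sum_mul]
  rw [sum_joint ch c hk]
  have herr : c.errorProb ch = ∑ m : Fin k, ∑ s, ∑ y, if c.dec y s ≠ m then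
      (1 / (k : ℝ)) * (∏ i, ch.pS (s i)) * c.outProb ch m s y else 0 := rfl
  rw [← herr]
  have h1 : ∑ m : Fin k, ∑ s, ∑ y, (1 / (k : ℝ)) * (∏ i, ch.pS (s i)) * b m s y ≤ 1 := by
    simp only [← Finset.mul_sum]
    calc ∑ m : Fin k, ∑ s, (1 / (k : ℝ)) * (∏ i, ch.pS (s i)) * ∑ y, b m s y
        ≤ ∑ m : Fin k, ∑ s : Fin n → 𝒮, (1 / (k : ℝ)) * (∏ i, ch.pS (s i)) := by
          refine Finset.sum_le_sum fun m _ => Finset.sum_le_sum fun s _ => ?_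
          exact mul_le_of_le_one_right (mul_nonneg (by positivity) (prod_pS_nonneg ch s))
            ((Finset.sum_le_sum fun y _ => hbB m s y).trans (hB s))
      _ = 1 := by
          simp only [← Finset.mul_sum, sum_prod_pS]
          simp [hk.ne']
  have h2 : ∑ m : Fin k, ∑ s, ∑ y, (if c.dec y s = m then (∏ i, ch.pS (s i)) * b m s y else 0)
      ≤ 1 := by
    -- Only the decoded message survives the sum over `m`, so `b (c.dec y s) s y ≤ B s y` bounds the
    -- rest.
    rw [Finset.sum_comm]
    calc ∑ s, ∑ m : Fin k, ∑ y, (if c.dec y s = m then (∏ i, ch.pS (s i)) * b m s y else 0)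
        = ∑ s, (∏ i, ch.pS (s i)) * ∑ y, b (c.dec y s) s y := by
          refine Finset.sum_congr rfl fun s _ => ?_
          rw [Finset.sum_comm, Finset.mul_sum]
          simp
      _ ≤ ∑ s : Fin n → 𝒮, ∏ i, ch.pS (s i) := by
          refine Finset.sum_le_sum fun s _ => mul_le_of_le_one_right (prod_pS_nonneg ch s)
            ((Finset.sum_le_sum fun y _ => hbB _ s y).trans (hB s))
      _ = 1 := sum_prod_pS ch
  linarith

/-- The time average of the expectation of `h (S_i, X_{r,i}, X_i)`. -/
def timeAverage (h : 𝒮 → 𝒳r → 𝒳 → ℝ) : ℝ :=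
  (1 / (n : ℝ)) * ∑ i : Fin n, (1 / (k : ℝ)) * ∑ m : Fin k, ∑ s : Fin n → 𝒮,
    (∏ j, ch.pS (s j)) * h (s i) (c.relaySymbol ch m s i) (c.srcSymbol m s i)

theorem sum_timeAverage {ι : Type*} [Fintype ι] (H : ι → 𝒮 → 𝒳r → 𝒳 → ℝ) :
    ∑ a, c.timeAverage ch (H a) = c.timeAverage ch fun s xr x => ∑ a, H a s xr x := by
  unfold timeAverage
  simp only [Finset.mul_sum]
  rw [Finset.sum_comm]
  refine Finset.sum_congr rfl fun i _ => ?_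
  rw [Finset.sum_comm]
  refine Finset.sum_congr rfl fun m _ => ?_
  rw [Finset.sum_comm]

end

variable {𝒳 𝒳r 𝒮 𝒴 𝒵 : Type*} [Fintype 𝒳] [Fintype 𝒳r] [Fintype 𝒮] [Fintype 𝒴]
  {n k : ℕ} (ch : RelayChannel 𝒳 𝒳r 𝒮 𝒴 𝒵) (c : RelayCode 𝒳 𝒳r 𝒮 𝒴 𝒵 n k)

/-- The time-averaged law of `(S, X_r, X)` has the form `p(s) p(x_r) p(x | x_r, s)`. -/
theorem exists_timeAverage_eq [Nonempty 𝒳] (hn : 0 < n) (hk : 0 < k) :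
    ∃ q ∈ stdSimplex ℝ 𝒳r, ∃ r : 𝒳r → 𝒮 → 𝒳 → ℝ, (∀ xr s, r xr s ∈ stdSimplex ℝ 𝒳) ∧
      ∀ h : 𝒮 → 𝒳r → 𝒳 → ℝ, c.timeAverage ch h =
        ∑ s, ∑ xr, ∑ x, ch.pS s * q xr * r xr s x * h s xr x := by
  classical
  have hnonneg : ∀ h, (∀ s xr x, 0 ≤ h s xr x) → 0 ≤ c.timeAverage ch h := by
    intro h hh
    unfold timeAverage
    refine mul_nonneg (by positivity) (Finset.sum_nonneg fun i _ => mul_nonneg (by positivity)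
      (Finset.sum_nonneg fun m _ => Finset.sum_nonneg fun s _ =>
        mul_nonneg (prod_pS_nonneg ch s) (hh _ _ _)))
  have hmul : ∀ (a : ℝ) (h : 𝒮 → 𝒳r → 𝒳 → ℝ),
      c.timeAverage ch h * a = c.timeAverage ch fun s xr x => h s xr x * a := by
    intro a h
    unfold timeAverage
    simp only [Finset.mul_sum, Finset.sum_mul, mul_assoc]
  have hone : c.timeAverage ch (fun _ _ _ => 1) = 1 := by
    unfold timeAverage
    simp [sum_prod_pS, hk.ne', hn.ne']
  let q : 𝒳r → ℝ := fun xr => c.timeAverage ch fun _ xr' _ => if xr' = xr then 1 else 0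
  let J : 𝒮 → 𝒳r → 𝒳 → ℝ := fun s xr x => c.timeAverage ch fun s' xr' x' =>
    if s' = s then if xr' = xr then if x' = x then 1 else 0 else 0 else 0
  have hJ0 : ∀ s xr x, 0 ≤ J s xr x := fun s xr x => hnonneg _ fun s' xr' x' => by
    split_ifs <;> simp
  have hq : q ∈ stdSimplex ℝ 𝒳r := by
    refine ⟨fun xr => hnonneg _ fun s' xr' x' => ?_, ?_⟩
    · split_ifs <;> simp
    · simp only [q]
      rw [sum_timeAverage]
      simp [hone]
  have hmarg : ∀ s xr, ∑ x, J s xr x = ch.pS s * q xr := by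
    intro s xr
    simp only [J, q]
    rw [sum_timeAverage]
    unfold timeAverage
    simp only [Finset.sum_ite_irrel, Finset.sum_ite_eq, Finset.mem_univ, if_true,
      Finset.sum_const_zero]
    rw [mul_left_comm]
    congr 1
    rw [Finset.mul_sum]
    refine Finset.sum_congr rfl fun i _ => ?_
    rw [mul_left_comm]
    congr 1
    rw [Finset.mul_sum]
    refine Finset.sum_congr rfl fun m _ => ?_
    -- Independence of `S_i` and the relay symbol at time `i`, for each message separately.
    have h1 := sum_pi_mul_of_update ch.sum_pS i (fun a => if a = s then 1 else 0)
      (fun s => if c.relaySymbol ch m s i = xr then 1 else 0)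
      (fun s a => by rw [relaySymbol_update])
    refine (Finset.sum_congr rfl fun s' _ => ?_).trans (h1.trans (by simp))
    split_ifs <;> simp
  -- The conditional law, with an arbitrary point mass where the conditioning event is null.
  let r : 𝒳r → 𝒮 → 𝒳 → ℝ := fun xr s => if ch.pS s * q xr = 0 then
    Pi.single (Classical.arbitrary 𝒳) 1 else fun x => J s xr x / (ch.pS s * q xr)
  have hr : ∀ xr s, r xr s ∈ stdSimplex ℝ 𝒳 := by
    intro xr s
    simp only [r]
    split_ifs with h
    · exact single_mem_stdSimplex _ _
    · refine ⟨fun x => div_nonneg (hJ0 _ _ _) (mul_nonneg (ch.pS_nonneg s) (hq.1 xr)), ?_⟩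
      rw [← Finset.sum_div, hmarg, div_self h]
  refine ⟨q, hq, r, hr, fun h => ?_⟩
  have hJr : ∀ s xr x, ch.pS s * q xr * r xr s x = J s xr x := by
    intro s xr x
    by_cases h0 : ch.pS s * q xr = 0
    · have h1 := hmarg s xr
      rw [h0, Finset.sum_eq_zero_iff_of_nonneg fun x _ => hJ0 s xr x] at h1
      rw [h0, zero_mul, h1 x (Finset.mem_univ x)]
    · simp only [r, if_neg h0]
      rw [mul_div_cancel₀ _ h0]
  simp only [hJr, J, hmul]
  simp only [sum_timeAverage]
  congr 1
  funext s xr x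
  simp [ite_mul, Finset.sum_ite_irrel]

variable {q : 𝒳r → ℝ} {r : 𝒳r → 𝒮 → 𝒳 → ℝ}

/-- For a comparison law that is a product of letters along the trajectory, the logarithm in Fano's
inequality splits over time, and the time average turns the sum into exactly `n` times one
expectation. -/
theorem one_sub_errorProb_mul_log_le (hn : 0 < n) (hk : 0 < k)
    (havg : ∀ h : 𝒮 → 𝒳r → 𝒳 → ℝ, c.timeAverage ch h =
        ∑ s, ∑ xr, ∑ x, ch.pS s * q xr * r xr s x * h s xr x)
    (β : 𝒮 → 𝒳r → 𝒳 → 𝒴 → ℝ) (hβ : ∀ s xr x y, 0 ≤ β s xr x y)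
    (hpos : ∀ s xr x y, q xr * r xr s x ≠ 0 → 0 < ch.W x xr s y → 0 < β s xr x y)
    (B : (Fin n → 𝒮) → (Fin n → 𝒴) → ℝ)
    (hbB : ∀ m s y,
      ∏ i, β (s i) (c.relaySymbol ch m s i) (c.srcSymbol m s i) (y i) ≤ B s y)
    (hB : ∀ s, ∑ y, B s y ≤ 1) :
    (1 - c.errorProb ch) * Real.log k - 1 ≤
      n * ch.expect q r fun s xr x y => Real.log (ch.W x xr s y / β s xr x y) := by
  classical
  have hsupp : ∀ (m : Fin k) (s : Fin n → 𝒮) (i : Fin n), 0 < ∏ j, ch.pS (s j) →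
      q (c.relaySymbol ch m s i) * r (c.relaySymbol ch m s i) (s i) (c.srcSymbol m s i) ≠ 0 := by
    intro m s i hs h0
    -- Testing the averaged law on the indicator of its own null set shows that the code visits that
    -- set with probability zero; hence `β` is positive at every visited triple with positive
    -- channel probability.
    have h1 := havg fun s' xr x => if q xr * r xr s' x = 0 then 1 else 0
    have h2 : ∑ s, ∑ xr, ∑ x, ch.pS s * q xr * r xr s x *
        (if q xr * r xr s x = 0 then 1 else 0) = 0 := by
      refine Finset.sum_eq_zero fun s _ => Finset.sum_eq_zero fun xr _ =>
        Finset.sum_eq_zero fun x _ => ?_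
      split_ifs with h
      · rw [mul_assoc (ch.pS s), h, mul_zero, zero_mul]
      · ring
    rw [h2, timeAverage] at h1
    have hn' : (0 : ℝ) < n := Nat.cast_pos.2 hn
    have hk' : (0 : ℝ) < k := Nat.cast_pos.2 hk
    have hnn : ∀ (i : Fin n) (m : Fin k) (s : Fin n → 𝒮), 0 ≤ (∏ j, ch.pS (s j)) *
        (if q (c.relaySymbol ch m s i) * r (c.relaySymbol ch m s i) (s i) (c.srcSymbol m s i) = 0
          then 1 else 0) := fun i m s =>
      mul_nonneg (prod_pS_nonneg ch s) (by split_ifs <;> simp)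
    rw [mul_eq_zero, or_iff_right (by positivity), Finset.sum_eq_zero_iff_of_nonneg fun i _ =>
      mul_nonneg (by positivity) (Finset.sum_nonneg fun m _ => Finset.sum_nonneg fun s _ =>
        hnn i m s)] at h1
    have h3 := h1 i (Finset.mem_univ i)
    rw [mul_eq_zero, or_iff_right (by positivity), Finset.sum_eq_zero_iff_of_nonneg fun m _ =>
      Finset.sum_nonneg fun s _ => hnn i m s] at h3
    have h4 := h3 m (Finset.mem_univ m)
    rw [Finset.sum_eq_zero_iff_of_nonneg fun s _ => hnn i m s] at h4
    have h5 := h4 s (Finset.mem_univ s)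
    rw [if_pos h0, mul_one] at h5
    exact hs.ne' h5
  refine (c.fano ch hk _ B (fun m s y => Finset.prod_nonneg fun i _ => hβ _ _ _ _) hbB hB
    ?_).trans (le_of_eq ?_)
  · intro m s y hs hW
    refine Finset.prod_pos fun i _ => hpos _ _ _ _ (hsupp m s i hs) ?_
    refine lt_of_le_of_ne (ch.W_nonneg _ _ _ _) fun h => hW.ne' ?_
    exact Finset.prod_eq_zero (Finset.mem_univ i) h.symm
  have h1 : ∀ (m : Fin k) (s : Fin n → 𝒮), ∑ y, (1 / (k : ℝ)) * (∏ i, ch.pS (s i)) *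
      c.outProb ch m s y * Real.log (c.outProb ch m s y /
        ∏ i, β (s i) (c.relaySymbol ch m s i) (c.srcSymbol m s i) (y i)) =
      ∑ i, (1 / (k : ℝ)) * ((∏ i, ch.pS (s i)) * ∑ y,
        ch.W (c.srcSymbol m s i) (c.relaySymbol ch m s i) (s i) y *
        Real.log (ch.W (c.srcSymbol m s i) (c.relaySymbol ch m s i) (s i) y /
          β (s i) (c.relaySymbol ch m s i) (c.srcSymbol m s i) y)) := by
    intro m s
    rcases (prod_pS_nonneg ch s).eq_or_lt with h0 | h0
    · simp [← h0]
    have h2 : ∀ y, c.outProb ch m s y * Real.log (c.outProb ch m s y /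
        ∏ i, β (s i) (c.relaySymbol ch m s i) (c.srcSymbol m s i) (y i)) =
        ∑ i, c.outProb ch m s y *
          Real.log (ch.W (c.srcSymbol m s i) (c.relaySymbol ch m s i) (s i) (y i) /
          β (s i) (c.relaySymbol ch m s i) (c.srcSymbol m s i) (y i)) := by
      intro y
      rcases (c.outProb_nonneg ch m s y).eq_or_lt with h3 | h3
      · simp [← h3]
      rw [← Finset.mul_sum, ← Real.log_prod, Finset.prod_div_distrib]
      · rfl
      intro i _
      have hW : ch.W (c.srcSymbol m s i) (c.relaySymbol ch m s i) (s i) (y i) ≠ 0 := fun h =>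
        h3.ne' (Finset.prod_eq_zero (Finset.mem_univ i) h)
      exact div_ne_zero hW (hpos _ _ _ _ (hsupp m s i h0)
        (lt_of_le_of_ne (ch.W_nonneg _ _ _ _) hW.symm)).ne'
    simp only [mul_assoc (1 / (k : ℝ) * ∏ i, ch.pS (s i)), h2]
    rw [← Finset.mul_sum, ← Finset.mul_sum, ← Finset.mul_sum, mul_assoc, Finset.sum_comm]
    congr 2
    refine Finset.sum_congr rfl fun i _ => ?_
    exact sum_pi_one (fun i => ch.W (c.srcSymbol m s i) (c.relaySymbol ch m s i) (s i))
      (fun i => ch.sum_W _ _ _) i fun y =>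
        Real.log (ch.W (c.srcSymbol m s i) (c.relaySymbol ch m s i) (s i) y /
          β (s i) (c.relaySymbol ch m s i) (c.srcSymbol m s i) y)
  have h2 := havg fun s xr x => ∑ y, ch.W x xr s y * Real.log (ch.W x xr s y / β s xr x y)
  have hn' : (n : ℝ) ≠ 0 := Nat.cast_ne_zero.2 hn.ne'
  simp only [h1]
  rw [RelayChannel.expect]
  simp only [Finset.mul_sum, ← mul_assoc] at h2
  simp only [← h2, timeAverage]
  rw [← mul_assoc, mul_one_div_cancel hn', one_mul]
  simp only [Finset.mul_sum]
  symm
  rw [Finset.sum_comm]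
  refine Finset.sum_congr rfl fun m _ => ?_
  rw [Finset.sum_comm]

section

variable [Nonempty 𝒳] [Fintype 𝒵]

/-- Both bounds use the same averaged pair `(q, r)`, so the minimum of the two terms is bounded at
one admissible point. -/
theorem exists_one_sub_errorProb_mul_log_le (hn : 0 < n) (hk : 0 < k) :
    ∃ q ∈ stdSimplex ℝ 𝒳r, ∃ r : 𝒳r → 𝒮 → 𝒳 → ℝ, (∀ xr s, r xr s ∈ stdSimplex ℝ 𝒳) ∧
      (1 - c.errorProb ch) * Real.log k - 1 ≤ n * Real.log 2 * ch.objective q r := by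
  obtain ⟨q, hq, r, hr, havg⟩ := c.exists_timeAverage_eq ch hn hk
  refine ⟨q, hq, r, hr, ?_⟩
  have hlog : 0 < Real.log 2 := Real.log_pos one_lt_two
  rw [ch.objective_eq hq hr, min_div_div_right hlog.le, mul_assoc, mul_div_cancel₀ _ hlog.ne']
  have h1 : (1 - c.errorProb ch) * Real.log k - 1 ≤ n * ch.expect q r (ch.outDensity q r) := by
    refine c.one_sub_errorProb_mul_log_le ch hn hk havg (fun s _ _ y => ch.outLaw q r s y)
      (fun s _ _ y => ch.outLaw_nonneg hq hr s y) (fun s xr x y h hW => ?_)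
      (fun s y => ∏ i, ch.outLaw q r (s i) (y i)) (fun m s y => le_rfl) fun s => ?_
    · exact (mul_pos (lt_of_le_of_ne (mul_nonneg (hq.1 xr) ((hr xr s).1 x)) h.symm) hW).trans_le
        (ch.le_outLaw hq hr x xr s y)
    · exact (sum_pi_prod_eq_one (w := fun i => ch.outLaw q r (s i))
        fun i => ch.sum_outLaw hq hr _).le
  have h2 : (1 - c.errorProb ch) * Real.log k - 1 ≤ n * ch.expect q r (ch.linkDensity r) := by
    refine c.one_sub_errorProb_mul_log_le ch hn hk havg
      (fun s xr x y => ch.linkLaw r xr s y (ch.z x xr s))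
      (fun s xr x y => ch.linkLaw_nonneg hr xr s y _) (fun s xr x y h hW => ?_)
      -- The true relay sequence is one of the summands, so this message-free sum dominates the
      -- product along the trajectory. Summing out `y` first leaves causal kernels in `z`, whose
      -- total mass is at most one.
      (fun s y => ∑ z : Fin n → 𝒵, ∏ i, ch.linkLaw r
        (c.relay i fun j => z ⟨j.val, j.isLt.trans i.isLt⟩) (s i) (y i) (z i))
      (fun m s y => ?_) fun s => ?_
    · exact (mul_pos (lt_of_le_of_ne ((hr xr s).1 x) (right_ne_zero_of_mul h).symm) hW).trans_le
        (ch.le_linkLaw hr x xr s y)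
    · refine le_trans (le_of_eq ?_) (Finset.single_le_sum (f := fun z : Fin n → 𝒵 =>
        ∏ i, ch.linkLaw r (c.relay i fun j => z ⟨j.val, j.isLt.trans i.isLt⟩) (s i) (y i) (z i))
        (fun z _ => Finset.prod_nonneg fun i _ => ch.linkLaw_nonneg hr _ _ _ _)
        (Finset.mem_univ (c.relaySignal ch m s)))
      refine Finset.prod_congr rfl fun i _ => ?_
      rw [relaySignal_eq, relaySymbol]
    · rw [Finset.sum_comm]
      refine le_trans (le_of_eq ?_) (sum_pi_causal_le_one (α := 𝒵) (n := n)
        (fun i h a => ∑ y, ch.linkLaw r (c.relay i h) (s i) y a)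
        (fun i h a => Finset.sum_nonneg fun y _ => ch.linkLaw_nonneg hr _ _ _ _)
        fun i h => (ch.sum_linkLaw hr _ _).le)
      refine Finset.sum_congr rfl fun z _ => ?_
      exact sum_pi_prod fun i y => ch.linkLaw r
        (c.relay i fun j => z ⟨j.val, j.isLt.trans i.isLt⟩) (s i) y (z i)
  rw [mul_min_of_nonneg _ _ (Nat.cast_nonneg n)]
  exact le_min h1 h2

end

end RelayCode

/-- The Fano bound gives `n ((1 - ε) R - C) log 2 ≤ 1` for all large `n`, so `(1 - ε) R ≤ C`; then
let `ε` tend to zero. -/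
theorem RelayChannel.Achievable.le {𝒳 𝒳r 𝒮 𝒴 𝒵 : Type*}
    [Fintype 𝒳] [Nonempty 𝒳] [Fintype 𝒳r] [Fintype 𝒮] [Fintype 𝒴] [Fintype 𝒵]
    {ch : RelayChannel 𝒳 𝒳r 𝒮 𝒴 𝒵} {R C : ℝ} (hR : ch.Achievable R)
    (hC : ∀ q ∈ stdSimplex ℝ 𝒳r, ∀ r : 𝒳r → 𝒮 → 𝒳 → ℝ,
      (∀ xr s, r xr s ∈ stdSimplex ℝ 𝒳) → ch.objective q r ≤ C) : R ≤ C := by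
  obtain ⟨hR0, hR⟩ := hR
  have hlog : 0 < Real.log 2 := Real.log_pos one_lt_two
  have key : ∀ ε : ℝ, 0 < ε → ε < 1 → (1 - ε) * R ≤ C := by
    intro ε hε hε1
    obtain ⟨n₀, hn₀⟩ := hR ε hε
    by_contra! hlt
    obtain ⟨N, hN⟩ := exists_nat_gt (1 / (((1 - ε) * R - C) * Real.log 2))
    have hd : 0 < ((1 - ε) * R - C) * Real.log 2 := mul_pos (sub_pos.2 hlt) hlog
    set n := max (max n₀ N) 1 with hn
    have hn1 : 0 < n := lt_of_lt_of_le one_pos (le_max_right _ _)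
    obtain ⟨c, hc⟩ := hn₀ n ((le_max_left _ _).trans (le_max_left _ _))
    have hpow : (0 : ℝ) < 2 ^ ((n : ℝ) * R) := Real.rpow_pos_of_pos two_pos _
    obtain ⟨q, hq, r, hr, h⟩ := c.exists_one_sub_errorProb_mul_log_le ch hn1 (Nat.ceil_pos.2 hpow)
    have h1 : n * R * Real.log 2 ≤ Real.log ⌈(2 : ℝ) ^ ((n : ℝ) * R)⌉₊ := by
      rw [← Real.log_rpow two_pos]
      exact Real.log_le_log hpow (Nat.le_ceil _)
    have h2 : 0 ≤ n * R * Real.log 2 := by positivity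
    have h3 : (1 - ε) * (n * R * Real.log 2) ≤
        (1 - c.errorProb ch) * Real.log ⌈(2 : ℝ) ^ ((n : ℝ) * R)⌉₊ :=
      mul_le_mul (by linarith) h1 h2 (by linarith)
    have h4 : n * Real.log 2 * ch.objective q r ≤ n * Real.log 2 * C :=
      mul_le_mul_of_nonneg_left (hC q hq r hr) (by positivity)
    have h5 : (N : ℝ) ≤ n := Nat.cast_le.2 ((le_max_right _ _).trans (le_max_left _ _))
    rw [div_lt_iff₀ hd] at hN
    have h6 := mul_le_mul_of_nonneg_right h5 hd.le
    nlinarith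
  refine le_of_forall_pos_le_add fun δ hδ => ?_
  have hε : 0 < min (1 / 2) (δ / (R + 1)) := by positivity
  have h1 := key _ hε (lt_of_le_of_lt (min_le_left _ _) (by norm_num))
  have h2 : min (1 / 2) (δ / (R + 1)) * R ≤ δ := by
    calc min (1 / 2) (δ / (R + 1)) * R ≤ δ / (R + 1) * (R + 1) :=
          mul_le_mul (min_le_right _ _) (by linarith) hR0 (by positivity)
      _ = δ := by field_simp
  linarith

end

/-! ### Random codebooks and the trajectories they generate. -/

noncomputable section

namespace RelayChannel

open FiniteInfo

/-- The part of a random codebook that is used at time `i`: a relay symbol for every past of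
the relay, and a source symbol for every message, relay symbol and state. -/
abbrev BookStep (𝒳 𝒳r 𝒮 𝒵 : Type*) (k i : ℕ) : Type _ :=
  ((Fin i → 𝒵) → 𝒳r) × (Fin k × 𝒳r × 𝒮 → 𝒳)

/-- A codebook of blocklength `n` for `k` messages. -/
abbrev Book (𝒳 𝒳r 𝒮 𝒵 : Type*) (k n : ℕ) : Type _ :=
  (i : Fin n) → BookStep 𝒳 𝒳r 𝒮 𝒵 k i.val

section Trajectory

variable {𝒳 𝒳r 𝒮 𝒴 𝒵 : Type*} [Fintype 𝒮] [Fintype 𝒴] (ch : RelayChannel 𝒳 𝒳r 𝒮 𝒴 𝒵) {k n : ℕ}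

/-- The signals that the relay receives when the codebook `c` is used. -/
def bookSignal (c : Book 𝒳 𝒳r 𝒮 𝒵 k n) (m : Fin k) (s : Fin n → 𝒮) (i : Fin n) : 𝒵 :=
  ch.z
    ((c i).2 (m, (c i).1 fun j => bookSignal c m s ⟨j.val, j.isLt.trans i.isLt⟩, s i))
    ((c i).1 fun j => bookSignal c m s ⟨j.val, j.isLt.trans i.isLt⟩) (s i)
termination_by i.val
decreasing_by all_goals exact j.isLt

/-- The relay symbol at time `i`. -/
def bookRelay (c : Book 𝒳 𝒳r 𝒮 𝒵 k n) (m : Fin k) (s : Fin n → 𝒮) (i : Fin n) : 𝒳r :=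
  (c i).1 fun j => ch.bookSignal c m s ⟨j.val, j.isLt.trans i.isLt⟩

/-- The source symbol at time `i`. -/
def bookSrc (c : Book 𝒳 𝒳r 𝒮 𝒵 k n) (m : Fin k) (s : Fin n → 𝒮) (i : Fin n) : 𝒳 :=
  (c i).2 (m, ch.bookRelay c m s i, s i)

theorem bookSignal_eq (c : Book 𝒳 𝒳r 𝒮 𝒵 k n) (m : Fin k) (s : Fin n → 𝒮) (i : Fin n) :
    ch.bookSignal c m s i = ch.z (ch.bookSrc c m s i) (ch.bookRelay c m s i) (s i) := by
  rw [bookSignal, bookSrc, bookRelay]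

/-- Causality, with different blocklengths allowed so that it covers both the truncated codebook
inside the encoder and the extension by one time step. -/
theorem bookSignal_congr {n' : ℕ} (c : Book 𝒳 𝒳r 𝒮 𝒵 k n) (c' : Book 𝒳 𝒳r 𝒮 𝒵 k n') (m : Fin k)
    (s : Fin n → 𝒮) (s' : Fin n' → 𝒮) (i : ℕ) (hi : i < n) (hi' : i < n')
    (hc : ∀ j (hj : j ≤ i), c ⟨j, hj.trans_lt hi⟩ = c' ⟨j, hj.trans_lt hi'⟩)
    (hs : ∀ j (hj : j ≤ i), s ⟨j, hj.trans_lt hi⟩ = s' ⟨j, hj.trans_lt hi'⟩) :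
    ch.bookSignal c m s ⟨i, hi⟩ = ch.bookSignal c' m s' ⟨i, hi'⟩ := by
  induction i using Nat.strong_induction_on with
  | _ i ih =>
    have h1 : (fun j : Fin i => ch.bookSignal c m s ⟨j.val, j.isLt.trans hi⟩) =
        fun j : Fin i => ch.bookSignal c' m s' ⟨j.val, j.isLt.trans hi'⟩ := by
      funext j
      exact ih j.val j.isLt _ _ (fun l hl => hc l (hl.trans j.isLt.le))
        fun l hl => hs l (hl.trans j.isLt.le)
    rw [bookSignal, bookSignal, hs i le_rfl, hc i le_rfl, h1]

/-- The code that uses the codebook `c` and the decoder `dec`. -/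
def bookCode (c : Book 𝒳 𝒳r 𝒮 𝒵 k n) (dec : (Fin n → 𝒴) → (Fin n → 𝒮) → Fin k) :
    RelayCode 𝒳 𝒳r 𝒮 𝒴 𝒵 n k where
  enc i m s := (c i).2 (m, (c i).1 (ch.bookSignal
    (fun j : Fin i.val => c ⟨j.val, j.isLt.trans i.isLt⟩) m fun j => s j.castSucc), s (Fin.last i))
  relay i h := (c i).1 h
  dec := dec

variable (c : Book 𝒳 𝒳r 𝒮 𝒵 k n) (dec : (Fin n → 𝒴) → (Fin n → 𝒮) → Fin k)

/-- The encoder simulates the relay from the codebook truncated before the current time and the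
states already seen; determinism of the link makes the simulation exact. -/
theorem bookCode_srcSymbol (m : Fin k) (s : Fin n → 𝒮) (i : Fin n) :
    (ch.bookCode c dec).srcSymbol m s i = ch.bookSrc c m s i := by
  have h : (ch.bookSignal (fun j : Fin i.val => c ⟨j.val, j.isLt.trans i.isLt⟩) m
      fun j => s ⟨j.val, j.isLt.trans i.isLt⟩) =
      fun j : Fin i.val => ch.bookSignal c m s ⟨j.val, j.isLt.trans i.isLt⟩ := by
    funext j
    exact ch.bookSignal_congr _ _ m _ _ j.val _ _ (fun l hl => rfl) fun l hl => rfl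
  unfold bookSrc bookRelay
  rw [← h]
  rfl

theorem bookCode_relaySignal (m : Fin k) (s : Fin n → 𝒮) (i : Fin n) :
    (ch.bookCode c dec).relaySignal ch m s i = ch.bookSignal c m s i := by
  obtain ⟨i, hi⟩ := i
  induction i using Nat.strong_induction_on with
  | _ i ih =>
    rw [RelayCode.relaySignal, bookSignal_eq, bookCode_srcSymbol]
    congr 1
    exact congrArg (c ⟨i, hi⟩).1 (funext fun j => ih j.val j.isLt _)

theorem bookCode_relaySymbol (m : Fin k) (s : Fin n → 𝒮) (i : Fin n) :
    (ch.bookCode c dec).relaySymbol ch m s i = ch.bookRelay c m s i := by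
  simp only [RelayCode.relaySymbol, bookCode_relaySignal]
  rfl

variable (st : BookStep 𝒳 𝒳r 𝒮 𝒵 k n) (m : Fin k) (s : Fin n → 𝒮) (a : 𝒮)

theorem bookSignal_snoc (i : Fin n) :
    ch.bookSignal (Fin.snoc c st : Book 𝒳 𝒳r 𝒮 𝒵 k (n + 1)) m
      (Fin.snoc s a : Fin (n + 1) → 𝒮) i.castSucc = ch.bookSignal c m s i := by
  refine ch.bookSignal_congr _ _ m _ _ i.val _ i.isLt (fun l hl => ?_) fun l hl => ?_
  · exact Fin.snoc_castSucc (α := fun i : Fin (n + 1) => BookStep 𝒳 𝒳r 𝒮 𝒵 k i.val) st c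
      ⟨l, hl.trans_lt i.isLt⟩
  · exact Fin.snoc_castSucc (α := fun _ => 𝒮) a s ⟨l, hl.trans_lt i.isLt⟩

theorem bookRelay_snoc (i : Fin n) :
    ch.bookRelay (Fin.snoc c st : Book 𝒳 𝒳r 𝒮 𝒵 k (n + 1)) m
      (Fin.snoc s a : Fin (n + 1) → 𝒮) i.castSucc = ch.bookRelay c m s i := by
  unfold bookRelay
  rw [Fin.snoc_castSucc (α := fun i : Fin (n + 1) => BookStep 𝒳 𝒳r 𝒮 𝒵 k i.val)]
  exact congrArg (c i).1 (funext fun j =>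
    ch.bookSignal_snoc c st m s a ⟨j.val, j.isLt.trans i.isLt⟩)

theorem bookSrc_snoc (i : Fin n) :
    ch.bookSrc (Fin.snoc c st : Book 𝒳 𝒳r 𝒮 𝒵 k (n + 1)) m
      (Fin.snoc s a : Fin (n + 1) → 𝒮) i.castSucc = ch.bookSrc c m s i := by
  unfold bookSrc
  rw [bookRelay_snoc, Fin.snoc_castSucc (α := fun i : Fin (n + 1) => BookStep 𝒳 𝒳r 𝒮 𝒵 k i.val),
    Fin.snoc_castSucc (α := fun _ => 𝒮)]

theorem bookRelay_snoc_last :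
    ch.bookRelay (Fin.snoc c st : Book 𝒳 𝒳r 𝒮 𝒵 k (n + 1)) m
      (Fin.snoc s a : Fin (n + 1) → 𝒮) (Fin.last n) = st.1 (ch.bookSignal c m s) := by
  unfold bookRelay
  rw [Fin.snoc_last]
  exact congrArg st.1 (funext fun j => ch.bookSignal_snoc c st m s a j)

theorem bookSrc_snoc_last :
    ch.bookSrc (Fin.snoc c st : Book 𝒳 𝒳r 𝒮 𝒵 k (n + 1)) m
      (Fin.snoc s a : Fin (n + 1) → 𝒮) (Fin.last n) =
      st.2 (m, st.1 (ch.bookSignal c m s), a) := by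
  unfold bookSrc
  rw [bookRelay_snoc_last, Fin.snoc_last, Fin.snoc_last]

end Trajectory

/-! ### One-letter bounds averaged over the random codebook. -/

section Weight

variable {𝒳 𝒳r 𝒮 𝒴 𝒵 : Type*} [Fintype 𝒳r] [Fintype 𝒮] [Fintype 𝒵] {k n : ℕ}

/-- The probability of the part of a random codebook that is used at time `n`. -/
def stepWeight (q : 𝒳r → ℝ) (r : 𝒳r → 𝒮 → 𝒳 → ℝ) (st : BookStep 𝒳 𝒳r 𝒮 𝒵 k n) : ℝ :=
  (∏ h, q (st.1 h)) * ∏ j, r j.2.1 j.2.2 (st.2 j)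

/-- The probability of a random codebook. -/
def bookWeight (q : 𝒳r → ℝ) (r : 𝒳r → 𝒮 → 𝒳 → ℝ) (c : Book 𝒳 𝒳r 𝒮 𝒵 k n) : ℝ :=
  ∏ i, stepWeight q r (c i)

variable {q : 𝒳r → ℝ} {r : 𝒳r → 𝒮 → 𝒳 → ℝ}

theorem bookWeight_snoc (c : Book 𝒳 𝒳r 𝒮 𝒵 k n) (st : BookStep 𝒳 𝒳r 𝒮 𝒵 k n) :
    bookWeight q r (Fin.snoc c st : Book 𝒳 𝒳r 𝒮 𝒵 k (n + 1)) =
      bookWeight q r c * stepWeight q r st := by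
  unfold bookWeight
  rw [Fin.prod_univ_castSucc]
  congr 1
  · refine Finset.prod_congr rfl fun i _ => ?_
    rw [Fin.snoc_castSucc (α := fun i : Fin (n + 1) => BookStep 𝒳 𝒳r 𝒮 𝒵 k i.val)]
  · rw [Fin.snoc_last]

variable [Fintype 𝒳]

theorem stepWeight_nonneg (hq : q ∈ stdSimplex ℝ 𝒳r) (hr : ∀ xr s, r xr s ∈ stdSimplex ℝ 𝒳)
    (st : BookStep 𝒳 𝒳r 𝒮 𝒵 k n) : 0 ≤ stepWeight q r st :=
  mul_nonneg (Finset.prod_nonneg fun _ _ => hq.1 _) (Finset.prod_nonneg fun _ _ => (hr _ _).1 _)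

theorem bookWeight_nonneg (hq : q ∈ stdSimplex ℝ 𝒳r) (hr : ∀ xr s, r xr s ∈ stdSimplex ℝ 𝒳)
    (c : Book 𝒳 𝒳r 𝒮 𝒵 k n) : 0 ≤ bookWeight q r c :=
  Finset.prod_nonneg fun _ _ => stepWeight_nonneg hq hr _

variable [DecidableEq 𝒳r] [DecidableEq 𝒮] [DecidableEq 𝒵]

theorem sum_stepWeight_single (hq : q ∈ stdSimplex ℝ 𝒳r) (hr : ∀ xr s, r xr s ∈ stdSimplex ℝ 𝒳)
    (m : Fin k) (s : 𝒮) (h : Fin n → 𝒵) (φ : 𝒳r → 𝒳 → ℝ) :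
    ∑ st : BookStep 𝒳 𝒳r 𝒮 𝒵 k n, stepWeight q r st * φ (st.1 h) (st.2 (m, st.1 h, s)) =
      ∑ xr, q xr * ∑ x, r xr s x * φ xr x := by
  rw [Fintype.sum_prod_type]
  have h1 : ∀ F : (Fin n → 𝒵) → 𝒳r, ∑ G : Fin k × 𝒳r × 𝒮 → 𝒳,
      stepWeight q r ((F, G) : BookStep 𝒳 𝒳r 𝒮 𝒵 k n) * φ (F h) (G (m, F h, s)) =
      (∏ h, q (F h)) * ∑ x, r (F h) s x * φ (F h) x := by
    intro F
    rw [← sum_pi_one (fun j : Fin k × 𝒳r × 𝒮 => r j.2.1 j.2.2) (fun j => (hr _ _).2)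
      (m, F h, s) (φ (F h)), Finset.mul_sum]
    exact Finset.sum_congr rfl fun G _ => mul_assoc _ _ _
  simp only [h1]
  exact sum_pi_one (fun _ => q) (fun _ => hq.2) h fun xr => ∑ x, r xr s x * φ xr x

theorem sum_stepWeight (hq : q ∈ stdSimplex ℝ 𝒳r) (hr : ∀ xr s, r xr s ∈ stdSimplex ℝ 𝒳) :
    ∑ st : BookStep 𝒳 𝒳r 𝒮 𝒵 k n, stepWeight q r st = 1 := by
  rw [Fintype.sum_prod_type]
  simp only [stepWeight]
  rw [← Finset.sum_mul_sum, sum_pi_prod_eq_one (w := fun _ => q) fun _ => hq.2,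
    sum_pi_prod_eq_one (w := fun j : Fin k × 𝒳r × 𝒮 => r j.2.1 j.2.2) fun j => (hr _ _).2,
    one_mul]

theorem sum_bookWeight (hq : q ∈ stdSimplex ℝ 𝒳r) (hr : ∀ xr s, r xr s ∈ stdSimplex ℝ 𝒳) :
    ∑ c : Book 𝒳 𝒳r 𝒮 𝒵 k n, bookWeight q r c = 1 := by
  induction n with
  | zero => simp [bookWeight]
  | succ n ih =>
    rw [sum_pi_snoc, ← ih]
    refine Finset.sum_congr rfl fun c _ => ?_
    exact (Finset.sum_congr rfl fun st _ => bookWeight_snoc c st).trans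
      (by rw [← Finset.mul_sum]; exact (congrArg _ (sum_stepWeight hq hr)).trans (mul_one _))

/-- Distinct messages read distinct entries of the source table even when their relay symbols
coincide, so given the relay table the source symbols are independent. -/
theorem sum_stepWeight_pair (hr : ∀ xr s, r xr s ∈ stdSimplex ℝ 𝒳)
    {m m' : Fin k} (hm : m ≠ m') (s : 𝒮) (h h' : Fin n → 𝒵) (φ : 𝒳r → 𝒳 → 𝒳r → 𝒳 → ℝ) :
    ∑ st : BookStep 𝒳 𝒳r 𝒮 𝒵 k n, stepWeight q r st *
        φ (st.1 h) (st.2 (m, st.1 h, s)) (st.1 h') (st.2 (m', st.1 h', s)) =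
      ∑ F : (Fin n → 𝒵) → 𝒳r, (∏ h, q (F h)) *
        ∑ x, r (F h) s x * ∑ x', r (F h') s x' * φ (F h) x (F h') x' := by
  rw [Fintype.sum_prod_type]
  refine Finset.sum_congr rfl fun F _ => ?_
  rw [← sum_pi_two (fun j : Fin k × 𝒳r × 𝒮 => r j.2.1 j.2.2) (fun j => (hr _ _).2)
    (i := (m, F h, s)) (j := (m', F h', s)) (fun e => hm (Prod.ext_iff.1 e).1)
    (fun x x' => φ (F h) x (F h') x'), Finset.mul_sum]
  exact Finset.sum_congr rfl fun G _ => mul_assoc _ _ _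

theorem sum_stepWeight_same (hq : q ∈ stdSimplex ℝ 𝒳r) (hr : ∀ xr s, r xr s ∈ stdSimplex ℝ 𝒳)
    {m m' : Fin k} (hm : m ≠ m') (s : 𝒮) (h : Fin n → 𝒵) (φ : 𝒳r → 𝒳 → 𝒳r → 𝒳 → ℝ) :
    ∑ st : BookStep 𝒳 𝒳r 𝒮 𝒵 k n, stepWeight q r st *
        φ (st.1 h) (st.2 (m, st.1 h, s)) (st.1 h) (st.2 (m', st.1 h, s)) =
      ∑ xr, q xr * ∑ x, r xr s x * ∑ x', r xr s x' * φ xr x xr x' := by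
  rw [sum_stepWeight_pair hr hm]
  exact sum_pi_one (fun _ => q) (fun _ => hq.2) h
    fun xr => ∑ x, r xr s x * ∑ x', r xr s x' * φ xr x xr x'

theorem sum_stepWeight_indep (hq : q ∈ stdSimplex ℝ 𝒳r) (hr : ∀ xr s, r xr s ∈ stdSimplex ℝ 𝒳)
    {m m' : Fin k} (hm : m ≠ m') (s : 𝒮) {h h' : Fin n → 𝒵} (hh : h ≠ h')
    (φ : 𝒳r → 𝒳 → 𝒳r → 𝒳 → ℝ) :
    ∑ st : BookStep 𝒳 𝒳r 𝒮 𝒵 k n, stepWeight q r st *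
        φ (st.1 h) (st.2 (m, st.1 h, s)) (st.1 h') (st.2 (m', st.1 h', s)) =
      ∑ xr, q xr * ∑ xr', q xr' * ∑ x, r xr s x * ∑ x', r xr' s x' * φ xr x xr' x' := by
  rw [sum_stepWeight_pair hr hm]
  exact sum_pi_two (fun _ => q) (fun _ => hq.2) hh
    fun xr xr' => ∑ x, r xr s x * ∑ x', r xr' s x' * φ xr x xr' x'

variable [Fintype 𝒴]

/-- The induction step in time: the entries for the last time are independent of the past, so they
can be averaged first. The bound on `D` is needed only where `A` is nonzero, which lets indicators
inside `A` supply information about the past. -/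
theorem sum_book_succ_le_one
    (hq : q ∈ stdSimplex ℝ 𝒳r) (hr : ∀ xr s, r xr s ∈ stdSimplex ℝ 𝒳)
    (A : Book 𝒳 𝒳r 𝒮 𝒵 k n → (Fin n → 𝒮) → (Fin n → 𝒴) → ℝ) (hA : ∀ c s y, 0 ≤ A c s y)
    (hA1 : ∑ c, ∑ s, ∑ y, bookWeight q r c * A c s y ≤ 1)
    (D : Book 𝒳 𝒳r 𝒮 𝒵 k n → (Fin n → 𝒮) → (Fin n → 𝒴) → BookStep 𝒳 𝒳r 𝒮 𝒵 k n → 𝒮 → 𝒴 → ℝ)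
    (hD : ∀ c s y, A c s y ≠ 0 → ∑ a, ∑ b, ∑ st, stepWeight q r st * D c s y st a b ≤ 1)
    (Φ : Book 𝒳 𝒳r 𝒮 𝒵 k (n + 1) → (Fin (n + 1) → 𝒮) → (Fin (n + 1) → 𝒴) → ℝ)
    (hΦ : ∀ c s y st a b, Φ (Fin.snoc c st) (Fin.snoc s a) (Fin.snoc y b) =
      A c s y * D c s y st a b) :
    ∑ c, ∑ s, ∑ y, bookWeight q r c * Φ c s y ≤ 1 := by
  refine le_trans ?_ hA1
  simp only [sum_pi_snoc]
  refine Finset.sum_le_sum fun c _ => ?_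
  rw [Finset.sum_comm]
  refine Finset.sum_le_sum fun s _ => ?_
  calc ∑ st : BookStep 𝒳 𝒳r 𝒮 𝒵 k n, ∑ a : 𝒮, ∑ y : Fin n → 𝒴, ∑ b : 𝒴,
        bookWeight q r (Fin.snoc c st : Book 𝒳 𝒳r 𝒮 𝒵 k (n + 1)) *
          Φ (Fin.snoc c st) (Fin.snoc s a) (Fin.snoc y b)
      = ∑ y : Fin n → 𝒴, bookWeight q r c * (A c s y *
          ∑ a, ∑ b, ∑ st, stepWeight q r st * D c s y st a b) := by
        simp only [Finset.mul_sum, bookWeight_snoc, hΦ]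
        rw [Finset.sum_comm, Finset.sum_congr rfl fun a _ => Finset.sum_comm, Finset.sum_comm]
        refine Finset.sum_congr rfl fun y _ => Finset.sum_congr rfl fun a _ => ?_
        rw [Finset.sum_comm]
        exact Finset.sum_congr rfl fun b _ => Finset.sum_congr rfl fun st _ => by ring
    _ ≤ ∑ y : Fin n → 𝒴, bookWeight q r c * A c s y := by
        refine Finset.sum_le_sum fun y _ => mul_le_mul_of_nonneg_left ?_
          (bookWeight_nonneg hq hr c)
        by_cases h0 : A c s y = 0
        · simp [h0]
        · exact mul_le_of_le_one_right (hA c s y) (hD c s y h0)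

variable (ch : RelayChannel 𝒳 𝒳r 𝒮 𝒴 𝒵)

/-- A one-letter bound on a nonnegative functional of the symbols of one message carries over to
the trajectory of that message in a random codebook. -/
theorem sum_book_single_le_one
    (hq : q ∈ stdSimplex ℝ 𝒳r) (hr : ∀ xr s, r xr s ∈ stdSimplex ℝ 𝒳) (m : Fin k) :
    ∀ {n : ℕ} (g : Fin n → 𝒮 → 𝒴 → 𝒳r → 𝒳 → ℝ), (∀ i s y xr x, 0 ≤ g i s y xr x) →
      (∀ i, ∑ s, ∑ y, ∑ xr, q xr * ∑ x, r xr s x * g i s y xr x ≤ 1) →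
      ∑ c : Book 𝒳 𝒳r 𝒮 𝒵 k n, ∑ s : Fin n → 𝒮, ∑ y : Fin n → 𝒴, bookWeight q r c *
        ∏ i, g i (s i) (y i) (ch.bookRelay c m s i) (ch.bookSrc c m s i) ≤ 1
  | 0, g, _, _ => by simp [bookWeight]
  | n + 1, g, h0, h1 => by
    refine sum_book_succ_le_one hq hr
      (fun c s y => ∏ i : Fin n, g i.castSucc (s i) (y i) (ch.bookRelay c m s i)
        (ch.bookSrc c m s i)) (fun c s y => Finset.prod_nonneg fun i _ => h0 _ _ _ _ _)
      (sum_book_single_le_one hq hr m (fun i => g i.castSucc) (fun i => h0 i.castSucc)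
        fun i => h1 i.castSucc)
      (fun c s y st a b => g (Fin.last n) a b (st.1 (ch.bookSignal c m s))
        (st.2 (m, st.1 (ch.bookSignal c m s), a))) (fun c s y _ => ?_) _ ?_
    · simp only [sum_stepWeight_single hq hr]
      exact h1 _
    · intro c s y st a b
      rw [Fin.prod_univ_castSucc]
      simp only [bookRelay_snoc_last, bookSrc_snoc_last, bookRelay_snoc, bookSrc_snoc,
        Fin.snoc_last, Fin.snoc_castSucc (α := fun _ : Fin (n + 1) => 𝒮),
        Fin.snoc_castSucc (α := fun _ : Fin (n + 1) => 𝒴)]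

/-- A one-letter bound for the trajectories of two messages, whose relay signals agree before time
`τ` and differ at time `τ`. The relay symbols agree up to time `τ` and are independent
afterwards. -/
theorem sum_book_pair_le_one
    (hq : q ∈ stdSimplex ℝ 𝒳r) (hr : ∀ xr s, r xr s ∈ stdSimplex ℝ 𝒳) {m m' : Fin k}
    (hm : m ≠ m') (τ : ℕ) :
    ∀ {n : ℕ} (g : Fin n → 𝒮 → 𝒴 → 𝒳r → 𝒳 → 𝒳r → 𝒳 → ℝ),
      (∀ i s y xr x xr' x', 0 ≤ g i s y xr x xr' x') →
      (∀ i : Fin n, i.val < τ → ∀ s y xr x xr' x', g i s y xr x xr' x' ≠ 0 →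
        ch.z x xr s = ch.z x' xr' s) →
      (∀ i : Fin n, i.val = τ → ∀ s y xr x xr' x', g i s y xr x xr' x' ≠ 0 →
        ch.z x xr s ≠ ch.z x' xr' s) →
      (∀ i : Fin n, i.val ≤ τ → ∑ s, ∑ y, ∑ xr, q xr * ∑ x, r xr s x * ∑ x', r xr s x' *
        g i s y xr x xr x' ≤ 1) →
      (∀ i : Fin n, τ < i.val → ∑ s, ∑ y, ∑ xr, q xr * ∑ xr', q xr' * ∑ x, r xr s x *
        ∑ x', r xr' s x' * g i s y xr x xr' x' ≤ 1) →
      ∑ c : Book 𝒳 𝒳r 𝒮 𝒵 k n, ∑ s : Fin n → 𝒮, ∑ y : Fin n → 𝒴, bookWeight q r c *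
        ∏ i, g i (s i) (y i) (ch.bookRelay c m s i) (ch.bookSrc c m s i)
          (ch.bookRelay c m' s i) (ch.bookSrc c m' s i) ≤ 1
  | 0, g, _, _, _, _, _ => by simp [bookWeight]
  | n + 1, g, h0, hlt, heq, h1, h2 => by
    refine sum_book_succ_le_one hq hr
      (fun c s y => ∏ i : Fin n, g i.castSucc (s i) (y i) (ch.bookRelay c m s i)
        (ch.bookSrc c m s i) (ch.bookRelay c m' s i) (ch.bookSrc c m' s i))
      (fun c s y => Finset.prod_nonneg fun i _ => h0 _ _ _ _ _ _ _)
      (sum_book_pair_le_one hq hr hm τ (fun i => g i.castSucc) (fun i => h0 i.castSucc)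
        (fun i => hlt i.castSucc) (fun i => heq i.castSucc) (fun i => h1 i.castSucc)
        fun i => h2 i.castSucc)
      (fun c s y st a b => g (Fin.last n) a b (st.1 (ch.bookSignal c m s))
        (st.2 (m, st.1 (ch.bookSignal c m s), a)) (st.1 (ch.bookSignal c m' s))
        (st.2 (m', st.1 (ch.bookSignal c m' s), a))) (fun c s y hne => ?_) _ ?_
    · rw [Finset.prod_ne_zero_iff] at hne
      -- A nonzero past product forces the relay signals to agree before `τ` and to differ at `τ`.
      -- So up to `τ` both messages read the same relay entry, and later they read different ones,
      -- since the full past indexes the entry.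
      by_cases hτ : n ≤ τ
      · have hh : ch.bookSignal c m' s = ch.bookSignal c m s := by
          funext i
          rw [bookSignal_eq, bookSignal_eq]
          exact (hlt i.castSucc (i.isLt.trans_le hτ) _ _ _ _ _ _
            (hne i (Finset.mem_univ i))).symm
        simp only [hh, sum_stepWeight_same hq hr hm _ _ (g (Fin.last n) _ _)]
        exact h1 (Fin.last n) hτ
      · rw [not_le] at hτ
        have hh : ch.bookSignal c m s ≠ ch.bookSignal c m' s := by
          intro h
          have h3 := heq (Fin.castSucc ⟨τ, hτ⟩) rfl _ _ _ _ _ _ (hne ⟨τ, hτ⟩ (Finset.mem_univ _))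
          rw [← bookSignal_eq, ← bookSignal_eq, h] at h3
          exact h3 rfl
        simp only [sum_stepWeight_indep hq hr hm _ hh (g (Fin.last n) _ _)]
        exact h2 (Fin.last n) hτ
    · intro c s y st a b
      rw [Fin.prod_univ_castSucc]
      simp only [bookRelay_snoc_last, bookSrc_snoc_last, bookRelay_snoc, bookSrc_snoc,
        Fin.snoc_last, Fin.snoc_castSucc (α := fun _ : Fin (n + 1) => 𝒮),
        Fin.snoc_castSucc (α := fun _ : Fin (n + 1) => 𝒴)]

end Weight

end RelayChannel

end

/-! ### Chernoff bound, threshold tests and the random coding bound. -/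

noncomputable section

/-- The Chernoff bound: exponential moments below the mean. -/
theorem FiniteInfo.exists_sum_mul_exp_le_one {Ω : Type*} [Fintype Ω] {p : Ω → ℝ}
    (hp : ∀ ω, 0 ≤ p ω) (hp1 : ∑ ω, p ω = 1) (X : Ω → ℝ) {a : ℝ} (ha : a < ∑ ω, p ω * X ω) :
    ∃ θ₀ > 0, ∀ θ, 0 < θ → θ ≤ θ₀ → ∑ ω, p ω * Real.exp (-θ * (X ω - a)) ≤ 1 := by
  set μ := ∑ ω, p ω * X ω - a with hμ
  have hμ0 : 0 < μ := sub_pos.2 ha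
  set M := ∑ ω, |X ω - a| + 1 with hM
  have hM0 : 0 < M := by positivity
  have hXM : ∀ ω, |X ω - a| ≤ M := fun ω =>
    (Finset.single_le_sum (f := fun ω => |X ω - a|) (fun ω _ => abs_nonneg _)
      (Finset.mem_univ ω)).trans (by linarith)
  -- From `e^u ≤ 1 + u + u²` for `|u| ≤ 1`, the moment is at most `1 + θ² M² - θ μ`; the two entries
  -- ensure `|u| ≤ 1` and `θ M² ≤ μ`. All small `θ` are covered, so two densities can share one.
  refine ⟨min (1 / M) (μ / M ^ 2), by positivity, fun θ hθ hle => ?_⟩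
  have h1 : θ * M ≤ 1 := by
    have := hle.trans (min_le_left _ _)
    rwa [le_div_iff₀ hM0] at this
  have h2 : θ * M ^ 2 ≤ μ := by
    have := hle.trans (min_le_right _ _)
    rwa [le_div_iff₀ (by positivity)] at this
  have h3 : ∀ ω, p ω * Real.exp (-θ * (X ω - a)) ≤
      p ω * (1 + θ ^ 2 * M ^ 2) - θ * (p ω * X ω - p ω * a) := by
    intro ω
    have habs : |-θ * (X ω - a)| ≤ 1 := by
      rw [abs_mul, abs_neg, abs_of_pos hθ]
      exact (mul_le_mul_of_nonneg_left (hXM ω) hθ.le).trans h1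
    have h4 := (abs_le.1 (Real.abs_exp_sub_one_sub_id_le habs)).2
    have h5 : (-θ * (X ω - a)) ^ 2 ≤ θ ^ 2 * M ^ 2 := by
      rw [mul_pow, neg_sq, ← sq_abs (X ω - a)]
      gcongr
      exact hXM ω
    have h6 : Real.exp (-θ * (X ω - a)) ≤ 1 + θ ^ 2 * M ^ 2 - θ * (X ω - a) := by linarith
    calc p ω * Real.exp (-θ * (X ω - a)) ≤ p ω * (1 + θ ^ 2 * M ^ 2 - θ * (X ω - a)) :=
          mul_le_mul_of_nonneg_left h6 (hp ω)
      _ = _ := by ring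
  refine (Finset.sum_le_sum fun ω _ => h3 ω).trans ?_
  rw [Finset.sum_sub_distrib, ← Finset.sum_mul, ← Finset.mul_sum, Finset.sum_sub_distrib,
    ← Finset.sum_mul, hp1, one_mul, one_mul, ← hμ]
  nlinarith

namespace RelayChannel

open FiniteInfo

section

variable {𝒳 𝒳r 𝒮 𝒴 𝒵 : Type*} [Fintype 𝒮] [Fintype 𝒴] (ch : RelayChannel 𝒳 𝒳r 𝒮 𝒴 𝒵)

/-- The joint probability of the states and the output, given the message. -/
def bookProb (ch : RelayChannel 𝒳 𝒳r 𝒮 𝒴 𝒵) {k n : ℕ}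
    (c : Book 𝒳 𝒳r 𝒮 𝒵 k n) (m : Fin k) (s : Fin n → 𝒮) (y : Fin n → 𝒴) : ℝ :=
  ∏ i, ch.pS (s i) * ch.W (ch.bookSrc c m s i) (ch.bookRelay c m s i) (s i) (y i)

theorem bookProb_nonneg {k n : ℕ} (c : Book 𝒳 𝒳r 𝒮 𝒵 k n) (m : Fin k) (s : Fin n → 𝒮)
    (y : Fin n → 𝒴) : 0 ≤ ch.bookProb c m s y :=
  Finset.prod_nonneg fun _ _ => mul_nonneg (ch.pS_nonneg _) (ch.W_nonneg _ _ _ _)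

variable [Fintype 𝒳] {r : 𝒳r → 𝒮 → 𝒳 → ℝ}

/-- A likelihood ratio averages to at most one under an independent draw of `x`. The guard `0 < W`
is needed because `exp (log 0) = 1`; a vanishing `linkLaw` is harmless since `0 / 0 = 0`. -/
theorem sum_mul_exp_linkDensity_le_one [DecidableEq 𝒵] (hr : ∀ xr s, r xr s ∈ stdSimplex ℝ 𝒳)
    (xr : 𝒳r) (s : 𝒮) (y : 𝒴) (z : 𝒵) :
    ∑ x, r xr s x * (if 0 < ch.W x xr s y then
      if z = ch.z x xr s then Real.exp (ch.linkDensity r s xr x y) else 0 else 0) ≤ 1 := by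
  classical
  have h1 : ∀ x, r xr s x * (if 0 < ch.W x xr s y then
      if z = ch.z x xr s then Real.exp (ch.linkDensity r s xr x y) else 0 else 0) ≤
      (if ch.z x xr s = z then r xr s x * ch.W x xr s y else 0) / ch.linkLaw r xr s y z := by
    intro x
    rcases ((hr xr s).1 x).eq_or_lt with h0 | h0
    · simp [← h0]
    by_cases hz : z = ch.z x xr s
    · subst hz
      simp only [if_true]
      split_ifs with hW
      · have hP := (mul_pos h0 hW).trans_le (ch.le_linkLaw hr x xr s y)
        rw [linkDensity, Real.exp_log (div_pos hW hP), mul_div_assoc]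
      · rw [mul_zero]
        exact div_nonneg (mul_nonneg h0.le (ch.W_nonneg _ _ _ _)) (ch.linkLaw_nonneg hr _ _ _ _)
    · simp [hz, Ne.symm hz]
  refine (Finset.sum_le_sum fun x _ => h1 x).trans ?_
  rw [← Finset.sum_div]
  refine le_trans (le_of_eq ?_) (div_self_le_one (ch.linkLaw r xr s y z))
  congr 1
  unfold linkLaw
  exact Finset.sum_congr rfl fun _ _ => by congr

end

section

variable {𝒳 𝒳r 𝒮 𝒴 𝒵 : Type*} [Fintype 𝒳] [Fintype 𝒳r] [Fintype 𝒮] [Fintype 𝒴]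
  (ch : RelayChannel 𝒳 𝒳r 𝒮 𝒴 𝒵) {q : 𝒳r → ℝ} {r : 𝒳r → 𝒮 → 𝒳 → ℝ}

theorem sum_eq_expect (f : 𝒮 → 𝒳r → 𝒳 → 𝒴 → ℝ) :
    ∑ s, ∑ y, ∑ xr, q xr * ∑ x, r xr s x * (ch.pS s * ch.W x xr s y * f s xr x y) =
      ch.expect q r f := by
  simp only [Finset.mul_sum, expect]
  refine Finset.sum_congr rfl fun s _ => ?_
  rw [Finset.sum_comm]
  refine Finset.sum_congr rfl fun xr _ => ?_
  rw [Finset.sum_comm]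
  exact Finset.sum_congr rfl fun x _ => Finset.sum_congr rfl fun y _ => by ring

theorem expect_one (hq : q ∈ stdSimplex ℝ 𝒳r) (hr : ∀ xr s, r xr s ∈ stdSimplex ℝ 𝒳) :
    ch.expect q r (fun _ _ _ _ => 1) = 1 := by
  simp [expect, ← Finset.mul_sum, sum_W, (hr _ _).2, hq.2, sum_pS]

theorem exists_expect_exp_le_one
    (hq : q ∈ stdSimplex ℝ 𝒳r) (hr : ∀ xr s, r xr s ∈ stdSimplex ℝ 𝒳)
    (f : 𝒮 → 𝒳r → 𝒳 → 𝒴 → ℝ) {a : ℝ} (ha : a < ch.expect q r f) :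
    ∃ θ₀ > 0, ∀ θ, 0 < θ → θ ≤ θ₀ →
      ch.expect q r (fun s xr x y => Real.exp (-θ * (f s xr x y - a))) ≤ 1 := by
  have h1 := ch.sum_jointPMF_mul (q := q) (r := r) fun _ => 1
  simp only [mul_one, ch.expect_one hq hr] at h1
  have h2 := ch.sum_jointPMF_mul (q := q) (r := r) fun ω => f ω.1 ω.2.1 ω.2.2.1 ω.2.2.2
  rw [← h2] at ha
  obtain ⟨θ₀, h0, h⟩ := exists_sum_mul_exp_le_one (p := ch.jointPMF q r)
    (fun ω => mul_nonneg (mul_nonneg (mul_nonneg (ch.pS_nonneg _) (hq.1 _)) ((hr _ _).1 _))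
      (ch.W_nonneg _ _ _ _)) h1 _ ha
  refine ⟨θ₀, h0, fun θ hθ hle => ?_⟩
  rw [← ch.sum_jointPMF_mul fun ω => Real.exp (-θ * (f ω.1 ω.2.1 ω.2.2.1 ω.2.2.2 - a))]
  exact h θ hθ hle

theorem sum_mul_exp_outDensity_le_one
    (hq : q ∈ stdSimplex ℝ 𝒳r) (hr : ∀ xr s, r xr s ∈ stdSimplex ℝ 𝒳) (s : 𝒮) (y : 𝒴) :
    ∑ xr, q xr * ∑ x, r xr s x * (if 0 < ch.W x xr s y then
      Real.exp (ch.outDensity q r s xr x y) else 0) ≤ 1 := by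
  have h1 : ∀ xr x, q xr * (r xr s x * (if 0 < ch.W x xr s y then
      Real.exp (ch.outDensity q r s xr x y) else 0)) ≤
      q xr * r xr s x * ch.W x xr s y / ch.outLaw q r s y := by
    intro xr x
    rw [← mul_assoc]
    rcases (mul_nonneg (hq.1 xr) ((hr xr s).1 x)).eq_or_lt with h0 | h0
    · simp [← h0]
    split_ifs with hW
    · have hP := (mul_pos h0 hW).trans_le (ch.le_outLaw hq hr x xr s y)
      rw [outDensity, Real.exp_log (div_pos hW hP), mul_div_assoc]
    · rw [mul_zero]
      exact div_nonneg (mul_nonneg h0.le (ch.W_nonneg _ _ _ _)) (ch.outLaw_nonneg hq hr _ _)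
  simp only [Finset.mul_sum]
  refine (Finset.sum_le_sum fun xr _ => Finset.sum_le_sum fun x _ => h1 xr x).trans ?_
  simp only [← Finset.sum_div]
  exact div_self_le_one _

/-- The density at time `i` of the test for a message whose relay signals differ from those of
the transmitted one for the first time at `τ`. -/
def testDensity (ch : RelayChannel 𝒳 𝒳r 𝒮 𝒴 𝒵) (q : 𝒳r → ℝ) (r : 𝒳r → 𝒮 → 𝒳 → ℝ) (τ i : ℕ)
    (s : 𝒮) (xr : 𝒳r) (x : 𝒳) (y : 𝒴) : ℝ :=
  -- At `τ` the relay inputs still agree but the signals do not, so neither ratio fits; dropping one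
  -- letter does not affect the rate.
  if i < τ then ch.linkDensity r s xr x y else if i = τ then 0 else ch.outDensity q r s xr x y

/-- The statistic of the test with first difference at `τ`. -/
def score (ch : RelayChannel 𝒳 𝒳r 𝒮 𝒴 𝒵) (q : 𝒳r → ℝ) (r : 𝒳r → 𝒮 → 𝒳 → ℝ) {k n : ℕ}
    (c : Book 𝒳 𝒳r 𝒮 𝒵 k n) (m : Fin k) (s : Fin n → 𝒮) (y : Fin n → 𝒴) (τ : ℕ) : ℝ :=
  ∑ i, ch.testDensity q r τ i.val (s i) (ch.bookRelay c m s i) (ch.bookSrc c m s i) (y i)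

/-- The message `m` passes all tests at threshold `γ`. -/
def Passes (ch : RelayChannel 𝒳 𝒳r 𝒮 𝒴 𝒵) (q : 𝒳r → ℝ) (r : 𝒳r → 𝒮 → 𝒳 → ℝ) (γ : ℝ) {k n : ℕ}
    (c : Book 𝒳 𝒳r 𝒮 𝒵 k n) (m : Fin k) (s : Fin n → 𝒮) (y : Fin n → 𝒴) : Prop :=
  (∀ i, 0 < ch.W (ch.bookSrc c m s i) (ch.bookRelay c m s i) (s i) (y i)) ∧
    ∀ τ ∈ Finset.range (n + 1), γ ≤ ch.score q r c m s y τ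

/-- The decoder that chooses a message which passes all tests. -/
def testDecoder (ch : RelayChannel 𝒳 𝒳r 𝒮 𝒴 𝒵) (q : 𝒳r → ℝ) (r : 𝒳r → 𝒮 → 𝒳 → ℝ) (γ : ℝ) {k n : ℕ}
    (hk : 0 < k) (c : Book 𝒳 𝒳r 𝒮 𝒵 k n) (y : Fin n → 𝒴) (s : Fin n → 𝒮) : Fin k :=
  open Classical in if h : ∃ m, ch.Passes q r γ c m s y then h.choose else ⟨0, hk⟩

variable [DecidableEq 𝒵]

/-- The likelihood ratio of the test with first difference at `τ`, restricted to the event that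
the relay signals of the two messages differ for the first time at `τ`. -/
def pairRatio (ch : RelayChannel 𝒳 𝒳r 𝒮 𝒴 𝒵) (q : 𝒳r → ℝ) (r : 𝒳r → 𝒮 → 𝒳 → ℝ) (τ i : ℕ)
    (s : 𝒮) (y : 𝒴) (xr : 𝒳r) (x : 𝒳) (xr' : 𝒳r) (x' : 𝒳) : ℝ :=
  if 0 < ch.W x' xr' s y then
    if i < τ then if ch.z x xr s = ch.z x' xr' s then Real.exp (ch.linkDensity r s xr' x' y) else 0
    else if i = τ then if ch.z x xr s = ch.z x' xr' s then 0 else 1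
    else Real.exp (ch.outDensity q r s xr' x' y)
  else 0

theorem pairRatio_nonneg (τ i : ℕ)
    (s : 𝒮) (y : 𝒴) (xr : 𝒳r) (x : 𝒳) (xr' : 𝒳r) (x' : 𝒳) :
    0 ≤ ch.pairRatio q r τ i s y xr x xr' x' := by
  unfold pairRatio
  split_ifs <;> positivity

/-- With the relay symbol shared, the average over `x'` for fixed output and signal is at most one:
by the `linkDensity` bound before `τ`, and because the ratio is an indicator at `τ`. -/
theorem sum_pairRatio_same_le_one
    (hq : q ∈ stdSimplex ℝ 𝒳r) (hr : ∀ xr s, r xr s ∈ stdSimplex ℝ 𝒳) {τ i : ℕ} (hi : i ≤ τ) :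
    ∑ s, ∑ y, ∑ xr, q xr * ∑ x, r xr s x * ∑ x', r xr s x' *
      (ch.pS s * ch.W x xr s y * ch.pairRatio q r τ i s y xr x xr x') ≤ 1 := by
  rw [← ch.expect_one hq hr, ← ch.sum_eq_expect]
  refine Finset.sum_le_sum fun s _ => Finset.sum_le_sum fun y _ => Finset.sum_le_sum fun xr _ =>
    mul_le_mul_of_nonneg_left (Finset.sum_le_sum fun x _ =>
      mul_le_mul_of_nonneg_left ?_ ((hr _ _).1 _)) (hq.1 _)
  have h1 : ∑ x', r xr s x' * ch.pairRatio q r τ i s y xr x xr x' ≤ 1 := by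
    rcases hi.lt_or_eq with hi | hi
    · simp only [pairRatio, hi, if_true]
      exact ch.sum_mul_exp_linkDensity_le_one hr xr s y (ch.z x xr s)
    · rw [← (hr xr s).2]
      refine Finset.sum_le_sum fun x' _ => mul_le_of_le_one_right ((hr _ _).1 _) ?_
      simp only [pairRatio, hi, lt_irrefl, if_false, if_true]
      split_ifs <;> norm_num
  calc ∑ x', r xr s x' * (ch.pS s * ch.W x xr s y * ch.pairRatio q r τ i s y xr x xr x')
      = ch.pS s * ch.W x xr s y * ∑ x', r xr s x' * ch.pairRatio q r τ i s y xr x xr x' := by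
        rw [Finset.mul_sum]
        exact Finset.sum_congr rfl fun x' _ => by ring
    _ ≤ ch.pS s * ch.W x xr s y * 1 :=
        mul_le_mul_of_nonneg_left h1 (mul_nonneg (ch.pS_nonneg _) (ch.W_nonneg _ _ _ _))

/-- The competing pair `(x_r', x')` is independent of the output given the state, so the sum factors
and the `outDensity` bound applies. -/
theorem sum_pairRatio_indep_le_one
    (hq : q ∈ stdSimplex ℝ 𝒳r) (hr : ∀ xr s, r xr s ∈ stdSimplex ℝ 𝒳) {τ i : ℕ} (hi : τ < i) :
    ∑ s, ∑ y, ∑ xr, q xr * ∑ xr', q xr' * ∑ x, r xr s x * ∑ x', r xr' s x' *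
      (ch.pS s * ch.W x xr s y * ch.pairRatio q r τ i s y xr x xr' x') ≤ 1 := by
  rw [← ch.expect_one hq hr, ← ch.sum_eq_expect]
  refine Finset.sum_le_sum fun s _ => Finset.sum_le_sum fun y _ => Finset.sum_le_sum fun xr _ =>
    mul_le_mul_of_nonneg_left ?_ (hq.1 _)
  simp only [pairRatio, hi.not_gt, hi.ne', if_false]
  have h1 := ch.sum_mul_exp_outDensity_le_one hq hr s y
  calc ∑ xr', q xr' * ∑ x, r xr s x * ∑ x', r xr' s x' * (ch.pS s * ch.W x xr s y *
        if 0 < ch.W x' xr' s y then Real.exp (ch.outDensity q r s xr' x' y) else 0)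
      = (∑ x, r xr s x * (ch.pS s * ch.W x xr s y * 1)) *
        ∑ xr', q xr' * ∑ x', r xr' s x' *
          (if 0 < ch.W x' xr' s y then Real.exp (ch.outDensity q r s xr' x' y) else 0) := by
        rw [Finset.mul_sum]
        refine Finset.sum_congr rfl fun xr' _ => ?_
        rw [mul_left_comm, Finset.sum_mul]
        congr 1
        refine Finset.sum_congr rfl fun x _ => ?_
        rw [mul_assoc (r xr s x)]
        congr 1
        rw [Finset.mul_sum]
        exact Finset.sum_congr rfl fun x' _ => by rw [mul_one, mul_left_comm]
    _ ≤ ∑ x, r xr s x * (ch.pS s * ch.W x xr s y * 1) := by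
        refine mul_le_of_le_one_right (Finset.sum_nonneg fun x _ => mul_nonneg ((hr _ _).1 _) ?_) h1
        exact mul_nonneg (mul_nonneg (ch.pS_nonneg _) (ch.W_nonneg _ _ _ _)) zero_le_one

variable [Fintype 𝒵] [DecidableEq 𝒳r] [DecidableEq 𝒮] {k n : ℕ}

/-- Each factor `exp (-θ (density - a))` has mean at most one. The exponent has `n - 1` because time
`τ`, if it occurs in the block, contributes no density. -/
theorem sum_book_score_le
    (hq : q ∈ stdSimplex ℝ 𝒳r) (hr : ∀ xr s, r xr s ∈ stdSimplex ℝ 𝒳) {θ a : ℝ} (hθ : 0 < θ)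
    (ha : 0 ≤ a)
    (h1 : ch.expect q r (fun s xr x y => Real.exp (-θ * (ch.outDensity q r s xr x y - a))) ≤ 1)
    (h2 : ch.expect q r (fun s xr x y => Real.exp (-θ * (ch.linkDensity r s xr x y - a))) ≤ 1)
    (m : Fin k) (τ : ℕ) :
    ∑ c : Book 𝒳 𝒳r 𝒮 𝒵 k n, ∑ s : Fin n → 𝒮, ∑ y : Fin n → 𝒴, bookWeight q r c *
      (ch.bookProb c m s y * Real.exp (-θ * ch.score q r c m s y τ)) ≤
      Real.exp (-θ * (a * (n - 1))) := by
  have key := ch.sum_book_single_le_one hq hr m (n := n) (fun i s y xr x =>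
    ch.pS s * ch.W x xr s y *
      Real.exp (-θ * (ch.testDensity q r τ i s xr x y - if i.val = τ then 0 else a)))
    (fun i s y xr x => mul_nonneg (mul_nonneg (ch.pS_nonneg _) (ch.W_nonneg _ _ _ _))
      (Real.exp_pos _).le) (fun i => by
        rw [ch.sum_eq_expect]
        rcases lt_trichotomy i.val τ with h | h | h
        · simpa only [testDensity, h, h.ne, if_true, if_false] using h2
        · simp only [testDensity, h, lt_irrefl, if_true, if_false, sub_zero, mul_zero,
            Real.exp_zero, ch.expect_one hq hr, le_refl]
        · simpa only [testDensity, h.not_gt, h.ne', if_true, if_false] using h1)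
  have hcount : a * (n - 1) ≤ ∑ i : Fin n, if i.val = τ then 0 else a := by
    have h3 : ∀ i : Fin n, (if i.val = τ then 0 else a) = a - if i.val = τ then a else 0 := by
      intro i
      split_ifs <;> simp
    have h4 : ∑ i : Fin n, (if i.val = τ then a else 0) ≤ a := by
      by_cases hτ : τ < n
      · rw [Finset.sum_eq_single_of_mem (⟨τ, hτ⟩ : Fin n) (Finset.mem_univ _)]
        · simp
        · intro i _ hi
          exact if_neg fun h => hi (Fin.ext h)
      · rw [Finset.sum_eq_zero]
        · exact ha
        · intro i _
          have hi : i.val ≠ τ := fun h => hτ (h ▸ i.isLt)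
          simp [hi]
    simp only [h3, Finset.sum_sub_distrib, Finset.sum_const, Finset.card_univ, Fintype.card_fin,
      nsmul_eq_mul]
    linarith
  have hpt : ∀ (c : Book 𝒳 𝒳r 𝒮 𝒵 k n) (s : Fin n → 𝒮) (y : Fin n → 𝒴), bookWeight q r c *
      (ch.bookProb c m s y * Real.exp (-θ * ch.score q r c m s y τ)) ≤
      Real.exp (-θ * (a * (n - 1))) * (bookWeight q r c *
      ∏ i, ch.pS (s i) * ch.W (ch.bookSrc c m s i) (ch.bookRelay c m s i) (s i) (y i) *
      Real.exp (-θ * (ch.testDensity q r τ i (s i) (ch.bookRelay c m s i) (ch.bookSrc c m s i) (y i)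
        - if i.val = τ then 0 else a))) := by
    intro c s y
    rw [mul_left_comm (Real.exp _), Finset.prod_mul_distrib, mul_left_comm (Real.exp _)]
    refine mul_le_mul_of_nonneg_left (mul_le_mul_of_nonneg_left ?_ (ch.bookProb_nonneg c m s y))
      (bookWeight_nonneg hq hr c)
    rw [← Real.exp_sum, ← Real.exp_add, Real.exp_le_exp, ← Finset.mul_sum,
      Finset.sum_sub_distrib]
    unfold score
    nlinarith
  refine (Finset.sum_le_sum fun c _ => Finset.sum_le_sum fun s _ => Finset.sum_le_sum fun y _ =>
    hpt c s y).trans ?_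
  simp only [← Finset.mul_sum] at key ⊢
  exact mul_le_of_le_one_right (Real.exp_pos _).le key

theorem sum_book_pairRatio_le
    (hq : q ∈ stdSimplex ℝ 𝒳r) (hr : ∀ xr s, r xr s ∈ stdSimplex ℝ 𝒳) {m m' : Fin k}
    (hm : m ≠ m') (τ : ℕ) :
    ∑ c : Book 𝒳 𝒳r 𝒮 𝒵 k n, ∑ s : Fin n → 𝒮, ∑ y : Fin n → 𝒴, bookWeight q r c *
      (ch.bookProb c m s y * ∏ i, ch.pairRatio q r τ i.val (s i) (y i) (ch.bookRelay c m s i)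
        (ch.bookSrc c m s i) (ch.bookRelay c m' s i) (ch.bookSrc c m' s i)) ≤ 1 := by
  simp only [bookProb, ← Finset.prod_mul_distrib]
  refine ch.sum_book_pair_le_one hq hr hm τ (n := n) (fun i s y xr x xr' x' =>
    ch.pS s * ch.W x xr s y * ch.pairRatio q r τ i.val s y xr x xr' x') ?_ ?_ ?_ ?_ ?_
  · exact fun i s y xr x xr' x' => mul_nonneg (mul_nonneg (ch.pS_nonneg _) (ch.W_nonneg _ _ _ _))
      (ch.pairRatio_nonneg _ _ _ _ _ _ _ _)
  · intro i hi s y xr x xr' x' h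
    by_contra hz
    exact right_ne_zero_of_mul h (by simp [pairRatio, hi, hz])
  · intro i hi s y xr x xr' x' h hz
    exact right_ne_zero_of_mul h (by simp [pairRatio, hi, hz])
  · exact fun i hi => ch.sum_pairRatio_same_le_one hq hr hi
  · exact fun i hi => ch.sum_pairRatio_indep_le_one hq hr hi

omit [Fintype 𝒵] [DecidableEq 𝒳r] [DecidableEq 𝒮] in
-- Choose `τ` as the first time at which the relay signals differ, or `n` if they never do. Then all
-- indicators hold and the product of ratios is exactly the exponential of the score of `m'`.
theorem exists_one_le_exp_mul_prod_pairRatio {γ : ℝ} {c : Book 𝒳 𝒳r 𝒮 𝒵 k n} (m : Fin k)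
    {m' : Fin k} {s : Fin n → 𝒮} {y : Fin n → 𝒴} (h : ch.Passes q r γ c m' s y) :
    ∃ τ ∈ Finset.range (n + 1), 1 ≤ Real.exp (-γ) *
      ∏ i, ch.pairRatio q r τ i.val (s i) (y i) (ch.bookRelay c m s i)
        (ch.bookSrc c m s i) (ch.bookRelay c m' s i) (ch.bookSrc c m' s i) := by
  obtain ⟨τ, hτ, hlt, heq⟩ : ∃ τ ∈ Finset.range (n + 1),
      (∀ i : Fin n, i.val < τ → ch.bookSignal c m s i = ch.bookSignal c m' s i) ∧
      ∀ i : Fin n, i.val = τ → ch.bookSignal c m s i ≠ ch.bookSignal c m' s i := by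
    by_cases hex : ∃ t, ∃ ht : t < n,
        ch.bookSignal c m s ⟨t, ht⟩ ≠ ch.bookSignal c m' s ⟨t, ht⟩
    · classical
      refine ⟨Nat.find hex, ?_, fun i hi => ?_, fun i hi => ?_⟩
      · obtain ⟨ht, _⟩ := Nat.find_spec hex
        exact Finset.mem_range.2 (ht.trans n.lt_succ_self)
      · by_contra hne
        exact Nat.find_min hex hi ⟨i.isLt, hne⟩
      · obtain ⟨ht, hne⟩ := Nat.find_spec hex
        rwa [show i = ⟨Nat.find hex, ht⟩ from Fin.ext hi]
    · push Not at hex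
      exact ⟨n, Finset.self_mem_range_succ n, fun i _ => hex i.val i.isLt,
        fun i hi => absurd hi i.isLt.ne⟩
  refine ⟨τ, hτ, ?_⟩
  have hprod : ∏ i, ch.pairRatio q r τ i.val (s i) (y i) (ch.bookRelay c m s i)
      (ch.bookSrc c m s i) (ch.bookRelay c m' s i) (ch.bookSrc c m' s i) =
      Real.exp (ch.score q r c m' s y τ) := by
    rw [score, Real.exp_sum]
    refine Finset.prod_congr rfl fun i _ => ?_
    rw [pairRatio, testDensity, if_pos (h.1 i), ← bookSignal_eq, ← bookSignal_eq]
    rcases lt_trichotomy i.val τ with hi | hi | hi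
    · simp [hi, hlt i hi]
    · simp [hi, heq i hi]
    · simp [hi.not_gt, hi.ne']
  rw [hprod, ← Real.exp_add, Real.one_le_exp_iff]
  have := h.2 τ hτ
  linarith

omit [Fintype 𝒵] [DecidableEq 𝒳r] [DecidableEq 𝒮] in
-- On an error, either the true message fails a test, and `exp (θ (γ - score)) ≥ 1` for some `τ`, or
-- the decoder chose a wrong message that passes, whose ratio is at least `exp γ` for some `τ`. A
-- zero channel factor makes the event null.
theorem errorProb_bookCode_le {γ θ : ℝ} (hθ : 0 < θ) (hk : 0 < k) (c : Book 𝒳 𝒳r 𝒮 𝒵 k n) :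
    (ch.bookCode c (ch.testDecoder q r γ hk c)).errorProb ch ≤
      ∑ m : Fin k, (1 / (k : ℝ)) * ∑ s, ∑ y,
        (∑ τ ∈ Finset.range (n + 1), Real.exp (θ * γ) *
          (ch.bookProb c m s y * Real.exp (-θ * ch.score q r c m s y τ)) +
        ∑ p ∈ Finset.univ.erase m ×ˢ Finset.range (n + 1), Real.exp (-γ) *
          (ch.bookProb c m s y * ∏ i, ch.pairRatio q r p.2 i.val (s i) (y i) (ch.bookRelay c m s i)
            (ch.bookSrc c m s i) (ch.bookRelay c p.1 s i) (ch.bookSrc c p.1 s i))) := by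
  classical
  simp only [Finset.mul_sum (a := 1 / (k : ℝ))]
  refine Finset.sum_le_sum fun m _ => Finset.sum_le_sum fun s _ => Finset.sum_le_sum fun y _ => ?_
  have hb := ch.bookProb_nonneg c m s y
  have hR0 : ∀ m' τ, 0 ≤ ∏ i : Fin n, ch.pairRatio q r τ i.val (s i) (y i) (ch.bookRelay c m s i)
      (ch.bookSrc c m s i) (ch.bookRelay c m' s i) (ch.bookSrc c m' s i) := fun m' τ =>
    Finset.prod_nonneg fun i _ => ch.pairRatio_nonneg _ _ _ _ _ _ _ _
  have hA : ∀ τ, 0 ≤ Real.exp (θ * γ) *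
      (ch.bookProb c m s y * Real.exp (-θ * ch.score q r c m s y τ)) := fun τ => by positivity
  have hB : ∀ m' τ, 0 ≤ Real.exp (-γ) *
      (ch.bookProb c m s y * ∏ i, ch.pairRatio q r τ i.val (s i) (y i) (ch.bookRelay c m s i)
        (ch.bookSrc c m s i) (ch.bookRelay c m' s i) (ch.bookSrc c m' s i)) := fun m' τ =>
    mul_nonneg (Real.exp_pos _).le (mul_nonneg hb (hR0 m' τ))
  have hA' := Finset.sum_nonneg fun τ (_ : τ ∈ Finset.range (n + 1)) => hA τ
  have hB' := Finset.sum_nonneg fun p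
    (_ : p ∈ Finset.univ.erase m ×ˢ Finset.range (n + 1)) => hB p.1 p.2
  simp only [bookCode_srcSymbol, bookCode_relaySymbol, mul_assoc]
  rw [← Finset.prod_mul_distrib, ← bookProb]
  split_ifs with hdec
  swap
  · exact mul_nonneg (by positivity) (add_nonneg hA' hB')
  refine mul_le_mul_of_nonneg_left ?_ (by positivity)
  by_cases hpass : ch.Passes q r γ c m s y
  · have hex : ∃ m, ch.Passes q r γ c m s y := ⟨m, hpass⟩
    have hd : (ch.bookCode c (ch.testDecoder q r γ hk c)).dec y s = hex.choose := by
      simp only [bookCode, testDecoder]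
      rw [dif_pos hex]
    obtain ⟨τ, hτ, h1⟩ := ch.exists_one_le_exp_mul_prod_pairRatio m hex.choose_spec
    rw [hd] at hdec
    refine le_add_of_nonneg_of_le hA' ?_
    refine le_trans ?_ (Finset.single_le_sum (fun p _ => hB p.1 p.2)
      (Finset.mk_mem_product (Finset.mem_erase.2 ⟨hdec, Finset.mem_univ _⟩) hτ))
    rw [mul_left_comm]
    exact le_mul_of_one_le_right hb h1
  · refine le_add_of_le_of_nonneg ?_ hB'
    by_cases hW : ∀ i, 0 < ch.W (ch.bookSrc c m s i) (ch.bookRelay c m s i) (s i) (y i)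
    · obtain ⟨τ, hτ, h1⟩ : ∃ τ ∈ Finset.range (n + 1), ch.score q r c m s y τ < γ := by
        by_contra! h
        exact hpass ⟨hW, h⟩
      refine le_trans ?_ (Finset.single_le_sum (fun τ _ => hA τ) hτ)
      rw [mul_left_comm, ← Real.exp_add]
      refine le_mul_of_one_le_right hb (Real.one_le_exp ?_)
      nlinarith
    · push Not at hW
      obtain ⟨i, hi⟩ := hW
      have h0 : ch.bookProb c m s y = 0 := Finset.prod_eq_zero (Finset.mem_univ i)
        (by rw [le_antisymm hi (ch.W_nonneg _ _ _ _), mul_zero])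
      rw [h0] at hA' ⊢
      exact hA'

/-- The random coding bound. -/
theorem exists_code_errorProb_le
    (hq : q ∈ stdSimplex ℝ 𝒳r) (hr : ∀ xr s, r xr s ∈ stdSimplex ℝ 𝒳) {θ a : ℝ} (hθ : 0 < θ)
    (ha : 0 ≤ a)
    (h1 : ch.expect q r (fun s xr x y => Real.exp (-θ * (ch.outDensity q r s xr x y - a))) ≤ 1)
    (h2 : ch.expect q r (fun s xr x y => Real.exp (-θ * (ch.linkDensity r s xr x y - a))) ≤ 1)
    (γ : ℝ) (n : ℕ) (hk : 0 < k) :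
    ∃ c : RelayCode 𝒳 𝒳r 𝒮 𝒴 𝒵 n k, c.errorProb ch ≤
      (n + 1) * (Real.exp (θ * γ) * Real.exp (-θ * (a * (n - 1))) + k * Real.exp (-γ)) := by
  set E := (n + 1) * (Real.exp (θ * γ) * Real.exp (-θ * (a * (n - 1))) + k * Real.exp (-γ)) with hE
  have hk' : (0 : ℝ) < k := Nat.cast_pos.2 hk
  have key : ∑ c : Book 𝒳 𝒳r 𝒮 𝒵 k n, bookWeight q r c *
      (ch.bookCode c (ch.testDecoder q r γ hk c)).errorProb ch ≤ E := by
    refine (Finset.sum_le_sum fun c _ => mul_le_mul_of_nonneg_left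
      (ch.errorProb_bookCode_le (q := q) (r := r) (γ := γ) hθ hk c)
      (bookWeight_nonneg hq hr c)).trans ?_
    have hswap : ∀ F : Book 𝒳 𝒳r 𝒮 𝒵 k n → Fin k → ℝ,
        ∑ c, bookWeight q r c * ∑ m, (1 / (k : ℝ)) * F c m =
        ∑ m, (1 / (k : ℝ)) * ∑ c, bookWeight q r c * F c m := by
      intro F
      simp only [Finset.mul_sum]
      rw [Finset.sum_comm]
      exact Finset.sum_congr rfl fun m _ => Finset.sum_congr rfl fun c _ => by ring
    rw [hswap]
    have hm : ∀ m : Fin k, ∑ c : Book 𝒳 𝒳r 𝒮 𝒵 k n, bookWeight q r c * ∑ s, ∑ y,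
        (∑ τ ∈ Finset.range (n + 1), Real.exp (θ * γ) *
          (ch.bookProb c m s y * Real.exp (-θ * ch.score q r c m s y τ)) +
        ∑ p ∈ Finset.univ.erase m ×ˢ Finset.range (n + 1), Real.exp (-γ) *
          (ch.bookProb c m s y * ∏ i, ch.pairRatio q r p.2 i.val (s i) (y i) (ch.bookRelay c m s i)
            (ch.bookSrc c m s i) (ch.bookRelay c p.1 s i) (ch.bookSrc c p.1 s i))) ≤ E := by
      intro m
      have hlin : ∀ {ι : Type} (T : Finset ι) (C : ℝ)
          (F : ι → Book 𝒳 𝒳r 𝒮 𝒵 k n → (Fin n → 𝒮) → (Fin n → 𝒴) → ℝ),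
          ∑ c, bookWeight q r c * ∑ s, ∑ y, ∑ t ∈ T, C * F t c s y =
          ∑ t ∈ T, C * ∑ c, ∑ s, ∑ y, bookWeight q r c * F t c s y := by
        intro ι T C F
        simp only [Finset.mul_sum]
        rw [Finset.sum_comm (s := T)]
        refine Finset.sum_congr rfl fun c _ => ?_
        rw [Finset.sum_comm (s := T)]
        refine Finset.sum_congr rfl fun s _ => ?_
        rw [Finset.sum_comm (s := T)]
        exact Finset.sum_congr rfl fun y _ => Finset.sum_congr rfl fun t _ => by ring
      simp only [Finset.sum_add_distrib, mul_add]
      rw [hlin, hlin _ _ (fun (p : Fin k × ℕ) c s y => ch.bookProb c m s y *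
        ∏ i, ch.pairRatio q r p.2 i.val (s i) (y i) (ch.bookRelay c m s i)
          (ch.bookSrc c m s i) (ch.bookRelay c p.1 s i) (ch.bookSrc c p.1 s i))]
      have hA : ∑ τ ∈ Finset.range (n + 1), Real.exp (θ * γ) * ∑ c : Book 𝒳 𝒳r 𝒮 𝒵 k n,
          ∑ s, ∑ y, bookWeight q r c *
          (ch.bookProb c m s y * Real.exp (-θ * ch.score q r c m s y τ)) ≤
          ∑ τ ∈ Finset.range (n + 1), Real.exp (θ * γ) * Real.exp (-θ * (a * (n - 1))) :=
        Finset.sum_le_sum fun τ _ => mul_le_mul_of_nonneg_left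
          (ch.sum_book_score_le hq hr hθ ha h1 h2 m τ) (Real.exp_pos _).le
      have hB : ∑ p ∈ Finset.univ.erase m ×ˢ Finset.range (n + 1), Real.exp (-γ) *
          ∑ c : Book 𝒳 𝒳r 𝒮 𝒵 k n, ∑ s, ∑ y, bookWeight q r c * (ch.bookProb c m s y *
          ∏ i, ch.pairRatio q r p.2 i.val (s i) (y i) (ch.bookRelay c m s i)
          (ch.bookSrc c m s i) (ch.bookRelay c p.1 s i) (ch.bookSrc c p.1 s i)) ≤
          ∑ p ∈ (Finset.univ : Finset (Fin k)) ×ˢ Finset.range (n + 1), Real.exp (-γ) := by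
        refine (Finset.sum_le_sum fun p hp => ?_).trans (Finset.sum_le_sum_of_subset_of_nonneg
          (Finset.product_subset_product_left (Finset.erase_subset m _))
          fun _ _ _ => (Real.exp_pos _).le)
        refine mul_le_of_le_one_right (Real.exp_pos _).le (ch.sum_book_pairRatio_le hq hr ?_ p.2)
        exact (Finset.mem_erase.1 (Finset.mem_product.1 hp).1).1.symm
      refine (add_le_add hA hB).trans (le_of_eq ?_)
      simp only [Finset.sum_const, Finset.card_range, Finset.card_product, Finset.card_univ,
        Fintype.card_fin, nsmul_eq_mul, hE]
      push_cast
      ring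
    refine (Finset.sum_le_sum fun m _ => mul_le_mul_of_nonneg_left (hm m) (by positivity)).trans
      (le_of_eq ?_)
    simp [hk'.ne']
  -- If every codebook exceeded `E`, so would the weighted average; strictness comes from a codebook
  -- of positive weight.
  by_contra! hcon
  have hone := sum_bookWeight (k := k) (n := n) (𝒵 := 𝒵) hq hr
  obtain ⟨c, _, hc⟩ : ∃ c ∈ (Finset.univ : Finset (Book 𝒳 𝒳r 𝒮 𝒵 k n)), 0 < bookWeight q r c := by
    by_contra! h
    linarith [Finset.sum_nonpos h]
  have hlt : ∑ c : Book 𝒳 𝒳r 𝒮 𝒵 k n, bookWeight q r c * E < ∑ c : Book 𝒳 𝒳r 𝒮 𝒵 k n,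
      bookWeight q r c * (ch.bookCode c (ch.testDecoder q r γ hk c)).errorProb ch :=
    Finset.sum_lt_sum (fun c _ => mul_le_mul_of_nonneg_left (hcon _).le (bookWeight_nonneg hq hr c))
      ⟨c, Finset.mem_univ c, mul_lt_mul_of_pos_left (hcon _) hc⟩
  rw [← Finset.sum_mul, hone, one_mul] at hlt
  exact absurd key (not_le.2 hlt)

end

end RelayChannel

end

/-! ### Achievability and the capacity theorem. -/

noncomputable section

namespace RelayChannel

theorem achievable_zero {𝒳 𝒳r 𝒮 𝒴 𝒵 : Type*} [Nonempty 𝒳] [Nonempty 𝒳r] [Fintype 𝒮] [Fintype 𝒴]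
    (ch : RelayChannel 𝒳 𝒳r 𝒮 𝒴 𝒵) : ch.Achievable 0 := by
  refine ⟨le_rfl, fun ε hε => ⟨0, fun n _ => ?_⟩⟩
  have h1 : ⌈(2 : ℝ) ^ ((n : ℝ) * 0)⌉₊ = 1 := by simp
  rw [h1]
  refine ⟨⟨fun _ _ _ => Classical.arbitrary 𝒳, fun _ _ => Classical.arbitrary 𝒳r,
    fun _ _ => 0⟩, le_of_eq_of_le ?_ hε.le⟩
  refine Finset.sum_eq_zero fun m _ => Finset.sum_eq_zero fun s _ => Finset.sum_eq_zero fun y _ =>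
    if_neg (not_not.2 (Subsingleton.elim _ _))

variable {𝒳 𝒳r 𝒮 𝒴 𝒵 : Type*} [Fintype 𝒳] [Fintype 𝒳r] [Fintype 𝒮] [Fintype 𝒴] [Fintype 𝒵]
  (ch : RelayChannel 𝒳 𝒳r 𝒮 𝒴 𝒵) {q : 𝒳r → ℝ} {r : 𝒳r → 𝒮 → 𝒳 → ℝ}

theorem achievable_of_lt_objective
    (hq : q ∈ stdSimplex ℝ 𝒳r) (hr : ∀ xr s, r xr s ∈ stdSimplex ℝ 𝒳) {R : ℝ} (hR : 0 ≤ R)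
    (h : R < ch.objective q r) : ch.Achievable R := by
  classical
  have hlog : 0 < Real.log 2 := Real.log_pos one_lt_two
  rw [ch.objective_eq hq hr, lt_min_iff, lt_div_iff₀ hlog, lt_div_iff₀ hlog, ← lt_min_iff] at h
  obtain ⟨b, hRb, hb⟩ := exists_between h
  obtain ⟨hb1, hb2⟩ := lt_min_iff.1 hb
  -- rate `R` (in nats) `< g < b`, where `b` bounds the test densities and `g` is the threshold
  obtain ⟨g, hRg, hgb⟩ := exists_between hRb
  have hRn : 0 ≤ R * Real.log 2 := by positivity
  obtain ⟨θ₁, hθ₁, h1⟩ := ch.exists_expect_exp_le_one hq hr _ hb1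
  obtain ⟨θ₂, hθ₂, h2⟩ := ch.exists_expect_exp_le_one hq hr _ hb2
  -- One exponent must serve both densities, as each test mixes them.
  set θ := min θ₁ θ₂
  have hθ : 0 < θ := lt_min hθ₁ hθ₂
  refine ⟨hR, fun ε hε => ?_⟩
  have hlim : ∀ δ : ℝ, 0 < δ →
      Filter.Tendsto (fun n : ℕ => ((n : ℝ) + 1) * Real.exp (-δ) ^ n) Filter.atTop (nhds 0) := by
    intro δ hδ
    have h3 : Real.exp (-δ) < 1 := (Real.exp_lt_exp.2 (by linarith)).trans_eq Real.exp_zero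
    have h4 := (tendsto_self_mul_const_pow_of_lt_one (Real.exp_pos (-δ)).le h3).add
      (tendsto_pow_atTop_nhds_zero_of_lt_one (Real.exp_pos (-δ)).le h3)
    simpa [add_mul] using h4
  have hlim' := ((hlim (θ * (b - g)) (mul_pos hθ (by linarith))).const_mul (Real.exp (θ * b))).add
    ((hlim (g - R * Real.log 2) (by linarith)).const_mul 2)
  simp only [mul_zero, add_zero] at hlim'
  obtain ⟨n₀, hn₀⟩ := Filter.eventually_atTop.1 (hlim'.eventually (gt_mem_nhds hε))
  refine ⟨n₀, fun n hn => ?_⟩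
  have hpow : (0 : ℝ) < 2 ^ ((n : ℝ) * R) := Real.rpow_pos_of_pos two_pos _
  obtain ⟨c, hc⟩ := ch.exists_code_errorProb_le hq hr hθ (by linarith)
    (h1 θ hθ (min_le_left _ _)) (h2 θ hθ (min_le_right _ _)) (n * g) n (Nat.ceil_pos.2 hpow)
  refine ⟨c, hc.trans (le_trans ?_ (hn₀ n hn).le)⟩
  -- Rounding the number of messages up costs at most a factor two.
  have hone : (1 : ℝ) ≤ 2 ^ ((n : ℝ) * R) := Real.one_le_rpow one_le_two (by positivity)
  have hk : (⌈(2 : ℝ) ^ ((n : ℝ) * R)⌉₊ : ℝ) ≤ 2 * Real.exp (n * (R * Real.log 2)) := by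
    have h3 := (Nat.ceil_lt_add_one hpow.le).le
    have h4 : (2 : ℝ) ^ ((n : ℝ) * R) = Real.exp (n * (R * Real.log 2)) := by
      rw [Real.rpow_def_of_pos two_pos]
      congr 1
      ring
    rw [← h4]
    linarith
  have e1 : Real.exp (θ * (n * g)) * Real.exp (-θ * (b * (n - 1))) =
      Real.exp (θ * b) * Real.exp (-(θ * (b - g))) ^ n := by
    rw [← Real.exp_nat_mul, ← Real.exp_add, ← Real.exp_add]
    congr 1
    ring
  have e2 : 2 * Real.exp (n * (R * Real.log 2)) * Real.exp (-(n * g)) =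
      2 * Real.exp (-(g - R * Real.log 2)) ^ n := by
    rw [← Real.exp_nat_mul, mul_assoc, ← Real.exp_add]
    congr 2
    ring
  rw [e1]
  have h5 := mul_le_mul_of_nonneg_right hk (Real.exp_pos (-(n * g))).le
  rw [e2] at h5
  calc _ ≤ ((n : ℝ) + 1) * (Real.exp (θ * b) * Real.exp (-(θ * (b - g))) ^ n +
        2 * Real.exp (-(g - R * Real.log 2)) ^ n) := by gcongr
    _ = _ := by ring

end RelayChannel

end

theorem theorem2 {𝒳 𝒳r 𝒮 𝒴 𝒵 : Type*}
    [Fintype 𝒳] [Nonempty 𝒳] [Fintype 𝒳r] [Nonempty 𝒳r] [Fintype 𝒮] [Fintype 𝒴] [Fintype 𝒵]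
    (ch : RelayChannel 𝒳 𝒳r 𝒮 𝒴 𝒵) :
    ∃ C : ℝ, ch.IsCapacity C ∧
      IsGreatest {v : ℝ | ∃ q ∈ stdSimplex ℝ 𝒳r, ∃ r : 𝒳r → 𝒮 → 𝒳 → ℝ,
        (∀ xr s, r xr s ∈ stdSimplex ℝ 𝒳) ∧ v = ch.objective q r} C := by
  obtain ⟨C, hC⟩ := ch.exists_isGreatest_objective
  refine ⟨C, ⟨fun R hR => RelayChannel.Achievable.le hR fun q hq r hr => hC.2 ⟨q, hq, r, hr, rfl⟩,
    fun b hb => ?_⟩, hC⟩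
  obtain ⟨⟨q, hq, r, hr, rfl⟩, -⟩ := hC
  refine le_of_forall_lt fun R hR => ?_
  obtain ⟨R', hRR', hR'⟩ := exists_between hR
  -- Negative values of `R'` are handled by the achievable rate zero, so the sign of the objective
  -- is never required.
  rcases le_or_gt 0 R' with h0 | h0
  · exact hRR'.trans_le (hb (ch.achievable_of_lt_objective hq hr h0 hR'))
  · exact hRR'.trans (h0.trans_le (hb ch.achievable_zero))
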